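/- Let $k$ be a field of characteristic $0$, $V$ a finite dimensional $k$-vector space and $A=S(V)$. Let $K=A\otimes\bigwedge^{\bullet}V\otimes A$ be the Koszul resolution of $A$ as an $A$-bimodule, where $K_i=A\otimes\bigwedge^iV\otimes A$, $o(v_1,\dots,v_i)$ denotes the element of $\bigwedge^i V$ given by $v_1,\dots,v_i\in V$, and $d_K$ is the $A$-bilinear map with $$d_K(1\otimes o(v_1,\dots,v_i)\otimes 1)=\sum_{j=1}^i(-1)^{j-1}\bigl(v_j\otimes o(v_1,\dots,\widehat{v_j},\dots,v_i)\otimes 1-1\otimes o(v_1,\dots,\widehat{v_j},\dots,v_i)\otimes v_j\bigr).$$ Let $\mu:K\to A$ be multiplication on $K_0=A\otimes A$ and $0$ on $K_i$, $i>0$; let $d_{K\otimes_AK}(x\otimes y)=d_Kx\otimes y+(-1)^{|x|}x\otimes d_Ky$, and $F_K=\mu\otimes\mathrm{id}_K-\mathrm{id}_K\otimes\mu:K\otimes_AK\to K$. For $s,t,z\ge 0$ and $1\le r\le t$ put $$c_r^{s,t,z}=\frac{(-1)^{sz+z}}{(s+t+z)!}\prod_{i=0}^{z-1}(r+i)\prod_{j=1}^{s}(t-r+j),\qquad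 \xi_r^{s,t,z}=\frac{(r+z-1)!\,(t-r+s)!}{(r-1)!\,(t-r)!\,(s+t+z)!}.$$ 1. There is one and only one $A$-bilinear (i.e. $A$-bimodule) map $\phi:K\otimes_AK\to K$ such that, for all $s,t,z\ge 0$ and all $u_1,\dots,u_s,v_1,\dots,v_t,w_1,\dots,w_z\in V$, $$\phi\bigl(1\otimes o(u_1,\dots,u_s)\otimes v_1\cdots v_t\otimes o(w_1,\dots,w_z)\otimes 1\bigr)$$ $$=\sum_{\sigma\in S_t,\ 1\le r\le t}c_r^{s,t,z}\,v_{\sigma(1)}\cdots v_{\sigma(r-1)}\otimes o(w_1,\dots,w_z,v_{\sigma(r)},u_1,\dots,u_s)\otimes v_{\sigma(r+1)}\cdots v_{\sigma(t)}.$$ This $\phi$ is $\mathrm{GL}(V)$-invariant, and it is a contracting homotopy for $F_K$: $$d_K\phi+\phi\, d_{K\otimes_AK}=F_K .$$ 2. One has $c_r^{s,t,z}=(-1)^{sz+z}\xi_r^{s,t,z}$ whenever $1\le r\le t$. 3. Let $\eta_r^{s,t,z}\in k$ be coefficients with $\eta_r^{0,t,0}=\frac1{t!}$ for $1\le r\le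 t$, and suppose that an $A$-bilinear map $\psi:K\otimes_AK\to K$ is given by the formula in 1 with $(-1)^{sz+z}\eta_r^{s,t,z}$ in place of $c_r^{s,t,z}$ and satisfies $d_K\psi+\psi\, d_{K\otimes_AK}=F_K$. Then $\eta_r^{s,t,z}=\xi_r^{s,t,z}$ whenever $1\le r\le t$ and $s+t+z\le\dim V$. -/

import Mathlib

open scoped TensorProduct

noncomputable section

namespace KoszulSym

section Balanced

variable {k A M N P : Type*} [CommRing k] [AddCommGroup A] [Module k A] [AddCommGroup M]
  [Module k M] [AddCommGroup N] [Module k N] [AddCommGroup P] [Module k P]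

/-- The relations `x a ⊗ y - x ⊗ a y` in `M ⊗_k N`, for a right action `ρ` of `A` on `M` and a left
action `l` of `A` on `N`. -/
def balanced (ρ : A →ₗ[k] M →ₗ[k] M) (l : A →ₗ[k] N →ₗ[k] N) : Submodule k (M ⊗[k] N) :=
  Submodule.span k {w | ∃ (a : A) (x : M) (y : N), w = ρ a x ⊗ₜ[k] y - x ⊗ₜ[k] l a y}

/-- `M ⊗_A N`, the tensor product of a right `A`-module `M` and a left `A`-module `N`: the quotient
of `M ⊗_k N` by the relations `x a ⊗ y = x ⊗ a y`. -/
def BalTensor (ρ : A →ₗ[k] M →ₗ[k] M) (l : A →ₗ[k] N →ₗ[k] N) : Type _ :=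
  (M ⊗[k] N) ⧸ balanced ρ l

variable (ρ : A →ₗ[k] M →ₗ[k] M) (l : A →ₗ[k] N →ₗ[k] N)

instance : AddCommGroup (BalTensor ρ l) :=
  inferInstanceAs (AddCommGroup ((M ⊗[k] N) ⧸ balanced ρ l))

instance : Module k (BalTensor ρ l) :=
  inferInstanceAs (Module k ((M ⊗[k] N) ⧸ balanced ρ l))

/-- The quotient map `M ⊗_k N → M ⊗_A N`. -/
def BalTensor.mk : M ⊗[k] N →ₗ[k] BalTensor ρ l := (balanced ρ l).mkQ

lemma BalTensor.mk_surjective : Function.Surjective (BalTensor.mk ρ l) :=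
  (balanced ρ l).mkQ_surjective

lemma BalTensor.mk_balanced (a : A) (x : M) (y : N) :
    BalTensor.mk ρ l (ρ a x ⊗ₜ y) = BalTensor.mk ρ l (x ⊗ₜ l a y) :=
  (Submodule.Quotient.eq _).2 (Submodule.subset_span ⟨a, x, y, rfl⟩)

/-- A linear map on `M ⊗_k N` that respects the relations descends to `M ⊗_A N`. -/
def BalTensor.lift (f : M ⊗[k] N →ₗ[k] P)
    (hf : ∀ a x y, f (ρ a x ⊗ₜ y) = f (x ⊗ₜ l a y)) : BalTensor ρ l →ₗ[k] P :=
  (balanced ρ l).liftQ f <| by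
    rw [balanced, Submodule.span_le]
    rintro _ ⟨a, x, y, rfl⟩
    simp [hf]

@[simp] lemma BalTensor.lift_mk (f : M ⊗[k] N →ₗ[k] P)
    (hf : ∀ a x y, f (ρ a x ⊗ₜ y) = f (x ⊗ₜ l a y)) (w : M ⊗[k] N) :
    BalTensor.lift ρ l f hf (BalTensor.mk ρ l w) = f w :=
  Submodule.liftQ_apply _ _ _

end Balanced

variable (k V : Type*) [Field k] [AddCommGroup V] [Module k V]

/-- The symmetric algebra `A = S(V)`. -/
abbrev A := SymmetricAlgebra k V

/-- The underlying space `A ⊗ Λ V ⊗ A` of the Koszul resolution `K` of `A`; the summand `K_i` is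
`A ⊗ Λ^i V ⊗ A`. -/
abbrev K := A k V ⊗[k] (ExteriorAlgebra k V ⊗[k] A k V)

/-- The left action of `A` on `K`: `a • (a' ⊗ ω ⊗ b) = a a' ⊗ ω ⊗ b`. -/
def lact : A k V →ₗ[k] K k V →ₗ[k] K k V :=
  LinearMap.rTensorHom (ExteriorAlgebra k V ⊗[k] A k V) ∘ₗ LinearMap.mul k (A k V)

/-- The right action of `A` on `K`: `(a ⊗ ω ⊗ b') • b = a ⊗ ω ⊗ b' b`. -/
def ract : A k V →ₗ[k] K k V →ₗ[k] K k V :=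
  LinearMap.lTensorHom (A k V) ∘ₗ LinearMap.lTensorHom (ExteriorAlgebra k V) ∘ₗ
    (LinearMap.mul k (A k V)).flip

variable {k V} in
@[simp] lemma lact_tmul (c a b : A k V) (ω : ExteriorAlgebra k V) :
    lact k V c (a ⊗ₜ (ω ⊗ₜ b)) = (c * a) ⊗ₜ (ω ⊗ₜ b) := rfl

variable {k V} in
@[simp] lemma ract_tmul (c a b : A k V) (ω : ExteriorAlgebra k V) :
    ract k V c (a ⊗ₜ (ω ⊗ₜ b)) = a ⊗ₜ (ω ⊗ₜ (b * c)) := rfl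

variable {k V} in
/-- `o(v_1, …, v_n) ∈ Λ^n V`, the wedge product of the `v_i`. -/
abbrev o {n : ℕ} (v : Fin n → V) : ExteriorAlgebra k V := ExteriorAlgebra.ιMulti k n v

/-- The map `ω ↦ 1 ⊗ ω ⊗ 1`. -/
def unitIncl : ExteriorAlgebra k V →ₗ[k] K k V :=
  TensorProduct.mk k (A k V) (ExteriorAlgebra k V ⊗[k] A k V) 1 ∘ₗ
    (TensorProduct.mk k (ExteriorAlgebra k V) (A k V)).flip 1

/-- `v ↦ (o(v_1, …, v_n) ↦ v ⊗ o(v_1, …, v_n) ⊗ 1 - 1 ⊗ o(v_1, …, v_n) ⊗ v)`. -/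
def dPre (n : ℕ) : V →ₗ[k] V [⋀^Fin n]→ₗ[k] K k V where
  toFun v := ((lact k V (SymmetricAlgebra.ι k V v) - ract k V (SymmetricAlgebra.ι k V v)) ∘ₗ
    unitIncl k V).compAlternatingMap (ExteriorAlgebra.ιMulti k n)
  map_add' v w := by
    ext x
    simp only [map_add, LinearMap.compAlternatingMap_apply, LinearMap.comp_apply,
      LinearMap.sub_apply, LinearMap.add_apply, AlternatingMap.add_apply]
    abel
  map_smul' c v := by
    ext x
    simp only [map_smul, LinearMap.compAlternatingMap_apply, LinearMap.comp_apply,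
      LinearMap.sub_apply, LinearMap.smul_apply, AlternatingMap.smul_apply, RingHom.id_apply,
      smul_sub]

/-- The restriction of the Koszul differential to `1 ⊗ Λ V ⊗ 1`. -/
def dGen : ExteriorAlgebra k V →ₗ[k] K k V :=
  ExteriorAlgebra.liftAlternating (R := k) fun n =>
    match n with
    | 0 => 0
    | n + 1 => AlternatingMap.alternatizeUncurryFin (dPre k V n)

/-- The Koszul differential `d_K`, the `A`-bilinear map with
`d (1 ⊗ o(v_1, …, v_n) ⊗ 1) = ∑_j (-1)^(j-1) (v_j ⊗ o(…, v̂_j, …) ⊗ 1 - 1 ⊗ o(…, v̂_j, …) ⊗ v_j)`;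
see `dK_o` below. -/
def dK : K k V →ₗ[k] K k V :=
  TensorProduct.lift
    (LinearMap.lcomp k (K k V) (TensorProduct.lift ((ract k V).flip ∘ₗ dGen k V)) ∘ₗ lact k V)

variable {k V} in
lemma dK_tmul (a b : A k V) (ω : ExteriorAlgebra k V) :
    dK k V (a ⊗ₜ (ω ⊗ₜ b)) = lact k V a (ract k V b (dGen k V ω)) := rfl

variable {k V} in
/-- The defining formula of the Koszul differential (indices start from `0`). -/
lemma dK_o {n : ℕ} (v : Fin (n + 1) → V) :
    dK k V (1 ⊗ₜ (o v ⊗ₜ 1)) = ∑ j : Fin (n + 1), (-1 : k) ^ (j : ℕ) •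
      (SymmetricAlgebra.ι k V (v j) ⊗ₜ[k] (o (j.removeNth v) ⊗ₜ[k] (1 : A k V)) -
        (1 : A k V) ⊗ₜ[k] (o (j.removeNth v) ⊗ₜ[k] SymmetricAlgebra.ι k V (v j))) := by
  have h : ∀ x : K k V, lact k V 1 (ract k V 1 x) = x := by
    intro x
    have h1 : lact k V 1 = LinearMap.id := by
      ext; simp
    have h2 : ract k V 1 = LinearMap.id := by
      ext; simp
    rw [h1, h2]; rfl
  rw [dK_tmul, h, dGen, ExteriorAlgebra.liftAlternating_apply_ιMulti]
  simp only [AlternatingMap.alternatizeUncurryFin_apply]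
  refine Finset.sum_congr rfl fun j _ => ?_
  have : dPre k V n (v j) (j.removeNth v) =
      SymmetricAlgebra.ι k V (v j) ⊗ₜ[k] (o (j.removeNth v) ⊗ₜ[k] (1 : A k V)) -
        (1 : A k V) ⊗ₜ[k] (o (j.removeNth v) ⊗ₜ[k] SymmetricAlgebra.ι k V (v j)) := by
    simp [dPre, unitIncl]
  rw [this, ← Int.cast_smul_eq_zsmul k]
  simp

variable {k V} in
/-- `d_K` vanishes on `K_0`. -/
lemma dK_zero (a b : A k V) : dK k V (a ⊗ₜ (1 ⊗ₜ b)) = 0 := by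
  rw [dK_tmul, dGen, ExteriorAlgebra.liftAlternating_one]
  simp

/-- The augmentation `μ : K → A`, the multiplication on `K_0 = A ⊗ A` and `0` on `K_i`, `i > 0`. -/
def mu : K k V →ₗ[k] A k V :=
  LinearMap.mul' k (A k V) ∘ₗ LinearMap.lTensor (A k V)
    ((TensorProduct.lid k (A k V)).toLinearMap ∘ₗ
      LinearMap.rTensor (A k V) (ExteriorAlgebra.algebraMapInv (R := k) (M := V)).toLinearMap)

variable {k V} in
lemma mu_tmul (a b : A k V) (ω : ExteriorAlgebra k V) :
    mu k V (a ⊗ₜ (ω ⊗ₜ b)) = ExteriorAlgebra.algebraMapInv ω • (a * b) := by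
  simp [mu]

/-- The sign map on `K`, multiplication by `(-1)^i` on `K_i`. -/
def sgn : K k V →ₗ[k] K k V :=
  LinearMap.lTensor (A k V) (LinearMap.rTensor (A k V)
    (ExteriorAlgebra.map (-LinearMap.id : V →ₗ[k] V)).toLinearMap)

variable {k V} in
lemma sgn_o {n : ℕ} (a b : A k V) (v : Fin n → V) :
    sgn k V (a ⊗ₜ (o v ⊗ₜ b)) = (-1 : k) ^ n • (a ⊗ₜ[k] (o v ⊗ₜ[k] b)) := by
  have : ExteriorAlgebra.map (-LinearMap.id : V →ₗ[k] V) (o v) = (-1 : k) ^ n • o v := by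
    rw [ExteriorAlgebra.map_apply_ιMulti]
    have := (ExteriorAlgebra.ιMulti k n (M := V)).map_smul_univ (fun _ => (-1 : k)) v
    simpa [Function.comp_def] using this
  simp only [sgn, LinearMap.lTensor_tmul, LinearMap.rTensor_tmul, AlgHom.toLinearMap_apply, this]
  rw [← TensorProduct.smul_tmul', TensorProduct.tmul_smul]

variable {k V} in
lemma dK_lact (a : A k V) (x : K k V) : dK k V (lact k V a x) = lact k V a (dK k V x) := by
  induction x using TensorProduct.induction_on with
  | zero => simp
  | add x y hx hy => simp only [map_add, hx, hy]
  | tmul b y =>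
    induction y using TensorProduct.induction_on with
    | zero => simp
    | add x y hx hy => simp only [TensorProduct.tmul_add, map_add, hx, hy]
    | tmul ω c =>
      rw [lact_tmul, dK_tmul, dK_tmul]
      have : lact k V (a * b) = lact k V a ∘ₗ lact k V b := by ext; simp [mul_assoc]
      rw [this]; rfl

variable {k V} in
lemma lact_ract (a b : A k V) (x : K k V) :
    lact k V a (ract k V b x) = ract k V b (lact k V a x) := by
  have : lact k V a ∘ₗ ract k V b = ract k V b ∘ₗ lact k V a := by ext; simp
  exact LinearMap.congr_fun this x

variable {k V} in
lemma dK_ract (a : A k V) (x : K k V) : dK k V (ract k V a x) = ract k V a (dK k V x) := by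
  induction x using TensorProduct.induction_on with
  | zero => simp
  | add x y hx hy => simp only [map_add, hx, hy]
  | tmul b y =>
    induction y using TensorProduct.induction_on with
    | zero => simp
    | add x y hx hy => simp only [TensorProduct.tmul_add, map_add, hx, hy]
    | tmul ω c =>
      rw [ract_tmul, dK_tmul, dK_tmul]
      have : ract k V (c * a) = ract k V a ∘ₗ ract k V c := by ext; simp [mul_assoc]
      rw [this, LinearMap.comp_apply, lact_ract]

variable {k V} in
lemma sgn_ract (a : A k V) (x : K k V) : sgn k V (ract k V a x) = ract k V a (sgn k V x) := by
  have : sgn k V ∘ₗ ract k V a = ract k V a ∘ₗ sgn k V := by ext; simp [sgn]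
  exact LinearMap.congr_fun this x

variable {k V} in
lemma mu_lact (a : A k V) (x : K k V) : mu k V (lact k V a x) = a * mu k V x := by
  have : mu k V ∘ₗ lact k V a = LinearMap.mulLeft k a ∘ₗ mu k V := by ext; simp [mu, mul_assoc]
  exact LinearMap.congr_fun this x

variable {k V} in
lemma mu_ract (a : A k V) (x : K k V) : mu k V (ract k V a x) = mu k V x * a := by
  have : mu k V ∘ₗ ract k V a = LinearMap.mulRight k a ∘ₗ mu k V := by
    ext; simp [mu, mul_assoc]
  exact LinearMap.congr_fun this x

/-- `K ⊗_A K`. -/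
abbrev KK := BalTensor (ract k V) (lact k V)

variable {k V} in
/-- The pure tensor `x ⊗_A y` in `K ⊗_A K`. -/
def tmulA (x y : K k V) : KK k V := BalTensor.mk (ract k V) (lact k V) (x ⊗ₜ[k] y)

variable {k V} in
lemma tmulA_balanced (a : A k V) (x y : K k V) :
    tmulA (ract k V a x) y = tmulA x (lact k V a y) :=
  BalTensor.mk_balanced _ _ a x y

/-- The differential of `K ⊗_A K`: `d (x ⊗ y) = d x ⊗ y + (-1)^|x| x ⊗ d y`. -/
def dKK : KK k V →ₗ[k] KK k V :=
  BalTensor.lift (ract k V) (lact k V)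
    (BalTensor.mk (ract k V) (lact k V) ∘ₗ
      (TensorProduct.map (dK k V) LinearMap.id + TensorProduct.map (sgn k V) (dK k V))) <| by
    intro a x y
    simp only [LinearMap.comp_apply, LinearMap.add_apply, TensorProduct.map_tmul,
      LinearMap.id_apply, dK_ract, dK_lact, sgn_ract, map_add, BalTensor.mk_balanced]

variable {k V} in
lemma dKK_tmulA (x y : K k V) :
    dKK k V (tmulA x y) = tmulA (dK k V x) y + tmulA (sgn k V x) (dK k V y) := by
  simp [dKK, tmulA]

/-- The chain map `F_K = μ ⊗ id - id ⊗ μ : K ⊗_A K → K`, `x ⊗ y ↦ μ(x) y - x μ(y)`. -/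
def FK : KK k V →ₗ[k] K k V :=
  BalTensor.lift (ract k V) (lact k V)
    (TensorProduct.lift (lact k V ∘ₗ mu k V) - TensorProduct.lift ((ract k V ∘ₗ mu k V).flip)) <| by
    intro a x y
    have hl : ∀ a b z, lact k V (b * a) z = lact k V b (lact k V a z) := by
      intro a b z
      have : lact k V (b * a) = lact k V b ∘ₗ lact k V a := by ext; simp [mul_assoc]
      rw [this]; rfl
    have hr : ∀ a b z, ract k V (a * b) z = ract k V b (ract k V a z) := by
      intro a b z
      have : ract k V (a * b) = ract k V b ∘ₗ ract k V a := by ext; simp [mul_assoc]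
      rw [this]; rfl
    simp only [LinearMap.sub_apply, TensorProduct.lift.tmul, LinearMap.comp_apply,
      LinearMap.flip_apply, mu_lact, mu_ract, hl, hr]

variable {k V} in
lemma FK_tmulA (x y : K k V) :
    FK k V (tmulA x y) = lact k V (mu k V x) y - ract k V (mu k V y) x := by
  simp [FK, tmulA]

variable {k V}

/-- `φ : K ⊗_A K → K` is `A`-bilinear, i.e. a map of `A`-bimodules. -/
def IsBilin (φ : KK k V →ₗ[k] K k V) : Prop :=
  (∀ (a : A k V) (x y : K k V), φ (tmulA (lact k V a x) y) = lact k V a (φ (tmulA x y))) ∧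
  (∀ (a : A k V) (x y : K k V), φ (tmulA x (ract k V a y)) = ract k V a (φ (tmulA x y)))

/-- The element `1 ⊗ o(u_1, …, u_s) ⊗ v_1 ⋯ v_t ⊗ o(w_1, …, w_z) ⊗ 1` of `K_s ⊗_A K_z`. -/
def monomial {s t z : ℕ} (u : Fin s → V) (v : Fin t → V) (w : Fin z → V) : KK k V :=
  tmulA ((1 : A k V) ⊗ₜ[k] (o u ⊗ₜ[k] ∏ i, SymmetricAlgebra.ι k V (v i)))
    ((1 : A k V) ⊗ₜ[k] (o w ⊗ₜ[k] (1 : A k V)))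

/-- `φ` is given on the monomials by the coefficients `c s t z r`, `1 ≤ r ≤ t`: it sends
`1 ⊗ o(u_1, …, u_s) ⊗ v_1 ⋯ v_t ⊗ o(w_1, …, w_z) ⊗ 1` to the sum over `r` and `σ ∈ S_t` of
`c s t z r` times `v_σ(1) ⋯ v_σ(r-1) ⊗ o(w_1, …, w_z, v_σ(r), u_1, …, u_s) ⊗ v_σ(r+1) ⋯ v_σ(t)`.
The index `r : Fin t` in the code starts from `0`. -/
def HasCoeffs (c : ℕ → ℕ → ℕ → ℕ → k) (φ : KK k V →ₗ[k] K k V) : Prop :=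
  ∀ (s t z : ℕ) (u : Fin s → V) (v : Fin t → V) (w : Fin z → V),
    φ (monomial u v w) = ∑ r : Fin t, ∑ σ : Equiv.Perm (Fin t), c s t z (r + 1) •
      ((∏ i ∈ Finset.Iio r, SymmetricAlgebra.ι k V (v (σ i))) ⊗ₜ[k]
        (o (Fin.append (Fin.snoc w (v (σ r)) : Fin (z + 1) → V) u) ⊗ₜ[k]
          ∏ i ∈ Finset.Ioi r, SymmetricAlgebra.ι k V (v (σ i))))

/-- The action of `g ∈ GL(V)` on `K` induced by its action on `V`. -/
def actK (g : V ≃ₗ[k] V) : K k V →ₗ[k] K k V :=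
  TensorProduct.map (SymmetricAlgebra.lift (SymmetricAlgebra.ι k V ∘ₗ g.toLinearMap)).toLinearMap
    (TensorProduct.map (ExteriorAlgebra.map g.toLinearMap).toLinearMap
      (SymmetricAlgebra.lift (SymmetricAlgebra.ι k V ∘ₗ g.toLinearMap)).toLinearMap)

/-- `φ` commutes with the (diagonal) action of `GL(V)`. -/
def IsGLInvariant (φ : KK k V →ₗ[k] K k V) : Prop :=
  ∀ (g : V ≃ₗ[k] V) (x y : K k V), φ (tmulA (actK g x) (actK g y)) = actK g (φ (tmulA x y))

/-- `φ` satisfies `d_K φ + φ d_{K ⊗_A K} = F_K`. -/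
def IsContractingHomotopy (φ : KK k V →ₗ[k] K k V) : Prop :=
  dK k V ∘ₗ φ + φ ∘ₗ dKK k V = FK k V

/-- The coefficient
`c_r^{s,t,z} = (-1)^(sz+z) / (s+t+z)! · ∏_{i=0}^{z-1} (r+i) · ∏_{j=1}^{s} (t-r+j)`. -/
def coeff (s t z r : ℕ) : ℚ :=
  (-1) ^ (s * z + z) / ((s + t + z).factorial : ℚ) *
    (∏ i ∈ Finset.range z, ((r : ℚ) + i)) * ∏ j ∈ Finset.Icc 1 s, ((t : ℚ) - r + j)

/-- `ξ_r^{s,t,z} = (r+z-1)! (t-r+s)! / ((r-1)! (t-r)! (s+t+z)!)`, used for `1 ≤ r ≤ t` only. -/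
def xi (s t z r : ℕ) : ℚ :=
  ((r + z - 1).factorial * (t - r + s).factorial : ℚ) /
    ((r - 1).factorial * (t - r).factorial * (s + t + z).factorial)

end KoszulSym

end

/-! The homotopy is an integral along the segment that joins the two outer copies of `A`. Regard `A
⊗ Λ V ⊗ A` as an algebra on which `d_K` is a superderivation with `d(1 ⊗ v ⊗ 1) = v ⊗ 1 - 1 ⊗ v`,
and adjoin a central variable `X`. The algebra map `interp` sends `v` to `X (v ⊗ 1) + (1 - X) (1 ⊗
v)`, hence is the left inclusion of `A` at `X = 1` and the right inclusion at `X = 0`. Let `D =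
derInterp` be the derivation over it with `D v = 1 ⊗ v ⊗ 1`, and let `ω(p)` be `ω` with each vector
multiplied by `p`. The derivative of `interp b` with respect to `X` is `d (D b)` (`dX_derInterp`).
Put `θ(ω, b, η) = D(b) ω(1 - X) η(X)`. The key identity `dX_homotopyForm` says that `d θ + θ d` is
the derivative of `interp(b) ω(1 - X) η(X)`. Integration over `[0, 1]` leaves the boundary values.
At `X = 1` only the degree zero part of `ω` survives, at `X = 0` only that of `η`, and the
difference is `F_K`. Characteristic `0` permits the integration. The coefficients come from
expanding `D(v_1 ⋯ v_t)` over the factor `v_i` that is differentiated and the set `S` of factors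
that go to the left. Each term is a Beta integral (`toAlg_homotopy_monomial`); collecting
permutations with the same `i` and `S` gives the stated sum (`sum_perm_eq`). Monomials generate `K
⊗_A K` as a bimodule, which gives uniqueness of `φ` and its invariance. For uniqueness of
coefficients, the homotopy identity is evaluated at `1 ⊗ o(u) ⊗ v^t ⊗ o(w) ⊗ 1` with one extra
independent vector `y` placed in `u` or in `w`. Linear forms on the outer factors isolate one term,
and `d_K` becomes a contraction of the exterior algebra. The resulting recursions
(`coeff_succ_left`, `coeff_succ_right`) reduce everything to `s = z = 0`. Since `φ` obeys them as
well, nothing has to be checked for `ξ` by hand. -/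

noncomputable section
namespace KoszulSym
variable (k V : Type*) [Field k] [AddCommGroup V] [Module k V]

/-! ### The Koszul complex as an algebra with a superderivation. -/

/-- `A ⊗ Λ V ⊗ A`, regarded as a `k`-algebra. -/
def KAlg : Type _ := K k V

instance : Ring (KAlg k V) := inferInstanceAs (Ring (K k V))
instance : Algebra k (KAlg k V) := inferInstanceAs (Algebra k (K k V))

/-- The identity map from `K` to the algebra `A ⊗ Λ V ⊗ A`. -/
def toAlg : K k V ≃ₗ[k] KAlg k V := LinearEquiv.refl k (K k V)

/-- The inclusion of the left factor `A` in the algebra `A ⊗ Λ V ⊗ A`. -/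
def inclL : A k V →ₐ[k] KAlg k V :=
  (Algebra.TensorProduct.includeLeft : A k V →ₐ[k] A k V ⊗[k] (ExteriorAlgebra k V ⊗[k] A k V))

/-- The inclusion of the factor `Λ V` in the algebra `A ⊗ Λ V ⊗ A`. -/
def inclW : ExteriorAlgebra k V →ₐ[k] KAlg k V :=
  (Algebra.TensorProduct.includeRight :
    ExteriorAlgebra k V ⊗[k] A k V →ₐ[k] A k V ⊗[k] (ExteriorAlgebra k V ⊗[k] A k V)).comp
    Algebra.TensorProduct.includeLeft

/-- The inclusion of the right factor `A` in the algebra `A ⊗ Λ V ⊗ A`. -/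
def inclR : A k V →ₐ[k] KAlg k V :=
  (Algebra.TensorProduct.includeRight :
    ExteriorAlgebra k V ⊗[k] A k V →ₐ[k] A k V ⊗[k] (ExteriorAlgebra k V ⊗[k] A k V)).comp
    Algebra.TensorProduct.includeRight

variable {k V}

lemma tmul_mul_tmul (a b a' b' : A k V) (ω ω' : ExteriorAlgebra k V) :
    toAlg k V (a ⊗ₜ (ω ⊗ₜ b)) * toAlg k V (a' ⊗ₜ (ω' ⊗ₜ b')) =
      toAlg k V ((a * a') ⊗ₜ ((ω * ω') ⊗ₜ (b * b'))) := by
  refine (Algebra.TensorProduct.tmul_mul_tmul a a' (ω ⊗ₜ[k] b) (ω' ⊗ₜ[k] b')).trans ?_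
  rw [Algebra.TensorProduct.tmul_mul_tmul]; rfl

lemma inclL_apply (a : A k V) : inclL k V a = toAlg k V (a ⊗ₜ (1 ⊗ₜ 1)) := rfl
lemma inclR_apply (a : A k V) : inclR k V a = toAlg k V (1 ⊗ₜ (1 ⊗ₜ a)) := rfl
lemma inclW_apply (a : ExteriorAlgebra k V) : inclW k V a = toAlg k V (1 ⊗ₜ (a ⊗ₜ 1)) := rfl

lemma toAlg_tmul (a b : A k V) (ω : ExteriorAlgebra k V) :
    toAlg k V (a ⊗ₜ (ω ⊗ₜ b)) = inclL k V a * inclW k V ω * inclR k V b := by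
  simp [inclL_apply, inclW_apply, inclR_apply, tmul_mul_tmul]

@[elab_as_elim]
lemma K_induction {P : K k V → Prop} (x : K k V) (zero : P 0) (add : ∀ x y, P x → P y → P (x + y))
    (tmul : ∀ a ω b, P (a ⊗ₜ (ω ⊗ₜ b))) : P x := by
  induction x using TensorProduct.induction_on with
  | zero => exact zero
  | add x y hx hy => exact add _ _ hx hy
  | tmul a y =>
    induction y using TensorProduct.induction_on with
    | zero => simpa using zero
    | add x y hx hy => rw [TensorProduct.tmul_add]; exact add _ _ hx hy
    | tmul ω c => exact tmul _ _ _

lemma toAlg_lact (a : A k V) (x : K k V) : toAlg k V (lact k V a x) = inclL k V a * toAlg k V x := by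
  induction x using K_induction with
  | zero => simp
  | add x y hx hy => simp only [map_add, hx, hy, mul_add]
  | tmul b ω c => simp [inclL_apply, tmul_mul_tmul]

lemma toAlg_ract (a : A k V) (x : K k V) : toAlg k V (ract k V a x) = toAlg k V x * inclR k V a := by
  induction x using K_induction with
  | zero => simp
  | add x y hx hy => simp only [map_add, hx, hy, add_mul]
  | tmul b ω c => simp [inclR_apply, tmul_mul_tmul]

/-- `A` is commutative and sits in degree `0`, so both outer copies of `A` are central and no signs
arise. This is what lets bimodule questions be treated as products in one algebra. -/
lemma inclL_comm (a : A k V) (x : KAlg k V) : inclL k V a * x = x * inclL k V a := by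
  obtain ⟨x, rfl⟩ := (toAlg k V).surjective x
  induction x using K_induction with
  | zero => simp
  | add x y hx hy => simp only [map_add, hx, hy, mul_add, add_mul]
  | tmul b ω c => simp [inclL_apply, tmul_mul_tmul, mul_comm a]

lemma inclR_comm (a : A k V) (x : KAlg k V) : inclR k V a * x = x * inclR k V a := by
  obtain ⟨x, rfl⟩ := (toAlg k V).surjective x
  induction x using K_induction with
  | zero => simp
  | add x y hx hy => simp only [map_add, hx, hy, mul_add, add_mul]
  | tmul b ω c => simp [inclR_apply, tmul_mul_tmul, mul_comm a]

@[elab_as_elim]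
lemma KAlg_induction {P : KAlg k V → Prop} (x : KAlg k V) (zero : P 0)
    (add : ∀ x y, P x → P y → P (x + y))
    (mul : ∀ a ω b, P (inclL k V a * (inclW k V ω * inclR k V b))) : P x := by
  obtain ⟨x, rfl⟩ := (toAlg k V).surjective x
  induction x using K_induction with
  | zero => simpa using zero
  | add x y hx hy => rw [map_add]; exact add _ _ hx hy
  | tmul b ω c => rw [toAlg_tmul, mul_assoc]; exact mul _ _ _

variable (k V) in
/-- The Koszul differential on the algebra `A ⊗ Λ V ⊗ A`. -/
def dAlg : KAlg k V →ₗ[k] KAlg k V :=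
  (toAlg k V).toLinearMap ∘ₗ dK k V ∘ₗ (toAlg k V).symm.toLinearMap

lemma toAlg_dK (x : K k V) : toAlg k V (dK k V x) = dAlg k V (toAlg k V x) := by simp [dAlg]

lemma dAlg_inclL_mul (a : A k V) (x : KAlg k V) :
    dAlg k V (inclL k V a * x) = inclL k V a * dAlg k V x := by
  obtain ⟨x, rfl⟩ := (toAlg k V).surjective x
  rw [← toAlg_lact, ← toAlg_dK, ← toAlg_dK, dK_lact, toAlg_lact]

lemma dAlg_mul_inclR (a : A k V) (x : KAlg k V) :
    dAlg k V (x * inclR k V a) = dAlg k V x * inclR k V a := by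
  obtain ⟨x, rfl⟩ := (toAlg k V).surjective x
  rw [← toAlg_ract, ← toAlg_dK, ← toAlg_dK, dK_ract, toAlg_ract]

lemma toAlg_dGen (ω : ExteriorAlgebra k V) : toAlg k V (dGen k V ω) = dAlg k V (inclW k V ω) := by
  rw [inclW_apply, ← toAlg_dK, dK_tmul, toAlg_lact, toAlg_ract]; simp

variable (k V) in
/-- `v ⊗ 1 - 1 ⊗ v`. -/
def diffLR : V →ₗ[k] KAlg k V :=
  ((inclL k V).toLinearMap - (inclR k V).toLinearMap) ∘ₗ SymmetricAlgebra.ι k V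

lemma diffLR_apply (v : V) : diffLR k V v =
    inclL k V (SymmetricAlgebra.ι k V v) - inclR k V (SymmetricAlgebra.ι k V v) := rfl

lemma span_o : Submodule.span k {ω : ExteriorAlgebra k V | ∃ n, ∃ v : Fin n → V, ω = o v} = ⊤ := by
  rw [← ExteriorAlgebra.ιMulti_span k V]
  congr 1
  ext ω
  constructor
  · rintro ⟨n, v, rfl⟩; exact ⟨⟨n, v⟩, rfl⟩
  · rintro ⟨⟨n, v⟩, rfl⟩; exact ⟨n, v, rfl⟩

lemma o_induction {P : ExteriorAlgebra k V → Prop} (ω : ExteriorAlgebra k V)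
    (ho : ∀ n (v : Fin n → V), P (o v)) (zero : P 0) (add : ∀ x y, P x → P y → P (x + y))
    (smul : ∀ (c : k) x, P x → P (c • x)) : P ω := by
  have h : ω ∈ Submodule.span k {ω : ExteriorAlgebra k V | ∃ n, ∃ v : Fin n → V, ω = o v} := by
    rw [span_o]; trivial
  induction h using Submodule.span_induction with
  | mem x h => obtain ⟨n, v, rfl⟩ := h; exact ho n v
  | zero => exact zero
  | add x y _ _ hx hy => exact add _ _ hx hy
  | smul c x _ hx => exact smul _ _ hx

lemma o_cons {n : ℕ} (u : V) (v : Fin n → V) :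
    (o (Fin.cons u v : Fin (n + 1) → V) : ExteriorAlgebra k V) = ExteriorAlgebra.ι k u * o v := by
  rw [o, ExteriorAlgebra.ιMulti_succ_apply]; rfl

lemma dAlg_one : dAlg k V 1 = 0 := by
  have : (1 : KAlg k V) = toAlg k V (1 ⊗ₜ (1 ⊗ₜ 1)) := rfl
  rw [this, ← toAlg_dK, dK_zero, map_zero]

lemma diffLR_comm (v : V) (x : KAlg k V) : diffLR k V v * x = x * diffLR k V v := by
  rw [diffLR_apply, sub_mul, mul_sub, inclL_comm, inclR_comm]

lemma dAlg_inclW_o {n : ℕ} (v : Fin (n + 1) → V) :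
    dAlg k V (inclW k V (o v)) = ∑ j : Fin (n + 1), (-1 : k) ^ (j : ℕ) •
      (diffLR k V (v j) * inclW k V (o (j.removeNth v))) := by
  rw [inclW_apply, ← toAlg_dK, dK_o, map_sum]
  refine Finset.sum_congr rfl fun j _ => ?_
  rw [map_smul]
  congr 1
  refine (map_sub (toAlg k V) _ _).trans ?_
  rw [toAlg_tmul, toAlg_tmul, diffLR_apply, sub_mul, inclR_comm]
  simp

/-- `d_K` is a superderivation: the case of a product with a vector. -/
lemma dAlg_inclW_ι_mul (u : V) (ω : ExteriorAlgebra k V) :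
    dAlg k V (inclW k V (ExteriorAlgebra.ι k u * ω)) =
      diffLR k V u * inclW k V ω -
        inclW k V (ExteriorAlgebra.ι k u) * dAlg k V (inclW k V ω) := by
  induction ω using o_induction with
  | zero => simp
  | add x y hx hy => simp only [mul_add, map_add, hx, hy]; abel
  | smul c x hx => simp only [mul_smul_comm, map_smul, hx, smul_sub]
  | ho n v =>
    have h1 : (Fin.removeNth 0 (Fin.cons u v : Fin (n + 1) → V)) = v := by
      ext; simp [Fin.removeNth]
    rw [← o_cons, dAlg_inclW_o, Fin.sum_univ_succ, h1, Fin.cons_zero, Fin.val_zero, pow_zero,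
      one_smul, sub_eq_add_neg (_ * _)]
    congr 1
    cases n with
    | zero =>
      have : (o v : ExteriorAlgebra k V) = 1 := ExteriorAlgebra.ιMulti_zero_apply v
      simp [this, dAlg_one]
    | succ n =>
      rw [dAlg_inclW_o, Finset.mul_sum, ← Finset.sum_neg_distrib]
      refine Finset.sum_congr rfl fun j _ => ?_
      have h2 : (Fin.removeNth j.succ (Fin.cons u v : Fin (n + 2) → V)) =
          Fin.cons u (j.removeNth v) := by
        ext i; refine Fin.cases ?_ (fun i => ?_) i <;> simp [Fin.removeNth]
      rw [h2, o_cons, map_mul (inclW k V), ← mul_assoc, diffLR_comm]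
      simp [pow_succ, mul_assoc]

@[elab_as_elim]
lemma ext_induction {P : ExteriorAlgebra k V → Prop} (ω : ExteriorAlgebra k V)
    (one : P 1) (add : ∀ x y, P x → P y → P (x + y)) (smul : ∀ (c : k) x, P x → P (c • x))
    (ι_mul : ∀ u x, P x → P (ExteriorAlgebra.ι k u * x)) : P ω := by
  refine CliffordAlgebra.left_induction (Q := (0 : QuadraticForm k V)) ?_ ?_ ?_ ω
  · intro r; rw [Algebra.algebraMap_eq_smul_one]; exact smul _ _ one
  · exact add
  · intro x u hx; exact ι_mul u x hx

variable (k V) in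
/-- The sign automorphism of `Λ V`. -/
def sgnW : ExteriorAlgebra k V →ₐ[k] ExteriorAlgebra k V :=
  ExteriorAlgebra.map (-LinearMap.id : V →ₗ[k] V)

lemma sgnW_ι (v : V) : sgnW k V (ExteriorAlgebra.ι k v) = -ExteriorAlgebra.ι k v := by
  simp [sgnW]

/-- The outer factors are central and `d` is linear over them, so the case of `Λ V` suffices. -/
lemma dAlg_inclW_ι_mul' (u : V) (x : KAlg k V) :
    dAlg k V (inclW k V (ExteriorAlgebra.ι k u) * x) = diffLR k V u * x -
      inclW k V (ExteriorAlgebra.ι k u) * dAlg k V x := by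
  induction x using KAlg_induction with
  | zero => simp
  | add x y hx hy => simp only [mul_add, map_add, hx, hy]; abel
  | mul a ω b =>
    have h : inclW k V (ExteriorAlgebra.ι k u) * (inclL k V a * (inclW k V ω * inclR k V b)) =
        inclL k V a * (inclW k V (ExteriorAlgebra.ι k u * ω) * inclR k V b) := by
      rw [map_mul, ← mul_assoc, ← inclL_comm]; simp only [mul_assoc]
    rw [h, dAlg_inclL_mul, dAlg_mul_inclR, dAlg_inclW_ι_mul, dAlg_inclL_mul, dAlg_mul_inclR]
    simp only [sub_mul, ← mul_assoc, inclL_comm a]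

/-! ### The universal derivation of the symmetric algebra. -/

/-- The universal derivation `A → A ⊗ V` as an algebra map to the square-zero extension. -/
def dualHom : A k V →ₐ[k] TrivSqZeroExt (A k V) (A k V ⊗[k] V) :=
  SymmetricAlgebra.lift
    ((TrivSqZeroExt.inlAlgHom k (A k V) (A k V ⊗[k] V)).toLinearMap ∘ₗ SymmetricAlgebra.ι k V +
      ((TrivSqZeroExt.inrHom (A k V) (A k V ⊗[k] V)).restrictScalars k) ∘ₗ
        TensorProduct.mk k (A k V) V 1)

/-- The universal derivation `A → A ⊗ V`, `v_1 ⋯ v_t ↦ ∑ v_1 ⋯ v̂_i ⋯ v_t ⊗ v_i`. -/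
def univD : A k V →ₗ[k] A k V ⊗[k] V :=
  ((TrivSqZeroExt.sndHom (A k V) (A k V ⊗[k] V)).restrictScalars k) ∘ₗ
    (dualHom (k := k) (V := V)).toLinearMap

lemma univD_ι (v : V) : univD (SymmetricAlgebra.ι k V v) = 1 ⊗ₜ v := by
  simp [univD, dualHom]

lemma fst_dualHom (a : A k V) : (dualHom a).fst = a := by
  have : (TrivSqZeroExt.fstHom k (A k V) (A k V ⊗[k] V)).comp dualHom = AlgHom.id k _ := by
    ext v; simp [dualHom]
  exact DFunLike.congr_fun this a

/-- This is the second component of the multiplicativity of `dualHom`, whose first component is the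
identity. -/
lemma univD_mul (a b : A k V) : univD (a * b) = a • univD b + b • univD a := by
  simp [univD, fst_dualHom]

lemma univD_one : univD (1 : A k V) = 0 := by
  simp [univD]

end KoszulSym
end

/-! ### Polynomials over the Koszul algebra: differential, derivative, integral. -/

noncomputable section
namespace KoszulSym
variable (k V : Type*) [Field k] [AddCommGroup V] [Module k V]

/-- The algebra `K[X]` of polynomials with coefficients in `A ⊗ Λ V ⊗ A`. -/
def KX : Type _ := KAlg k V ⊗[k] Polynomial k

instance : Ring (KX k V) := inferInstanceAs (Ring (KAlg k V ⊗[k] Polynomial k))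
instance : Algebra k (KX k V) := inferInstanceAs (Algebra k (KAlg k V ⊗[k] Polynomial k))

/-- The identity map from `K ⊗ k[X]` to the algebra `K[X]`. -/
def toX : KAlg k V ⊗[k] Polynomial k ≃ₐ[k] KX k V := AlgEquiv.refl

/-- The constant polynomials. -/
def cst : KAlg k V →ₐ[k] KX k V :=
  (toX k V).toAlgHom.comp Algebra.TensorProduct.includeLeft

/-- The polynomials with coefficients in `k`. -/
def scal : Polynomial k →ₐ[k] KX k V :=
  (toX k V).toAlgHom.comp Algebra.TensorProduct.includeRight

/-- The Koszul differential, applied to the coefficients. -/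
def dX : KX k V →ₗ[k] KX k V :=
  (toX k V).toLinearMap ∘ₗ LinearMap.rTensor _ (dAlg k V) ∘ₗ (toX k V).symm.toLinearMap

/-- The derivative with respect to `X`. -/
def derX : KX k V →ₗ[k] KX k V :=
  (toX k V).toLinearMap ∘ₗ LinearMap.lTensor _ Polynomial.derivative ∘ₗ (toX k V).symm.toLinearMap

/-- The integral over `[0, 1]` of a polynomial over `k`. -/
def integ : Polynomial k →ₗ[k] k :=
  Polynomial.lsum fun n => ((n : k) + 1)⁻¹ • LinearMap.id

/-- The integral over `[0, 1]` of a polynomial over `A ⊗ Λ V ⊗ A`. -/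
def integX : KX k V →ₗ[k] KAlg k V :=
  (TensorProduct.rid k (KAlg k V)).toLinearMap ∘ₗ LinearMap.lTensor _ (integ k) ∘ₗ
    (toX k V).symm.toLinearMap

/-- The evaluation of a polynomial over `A ⊗ Λ V ⊗ A` at `c`. -/
def evalX (c : k) : KX k V →ₐ[k] KAlg k V :=
  ((Algebra.TensorProduct.rid k k (KAlg k V)).toAlgHom.comp
    (Algebra.TensorProduct.map (AlgHom.id k _) (Polynomial.aeval c))).comp (toX k V).symm.toAlgHom

variable {k V}

lemma cst_mul_scal (x : KAlg k V) (p : Polynomial k) :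
    cst k V x * scal k V p = toX k V (x ⊗ₜ p) := by
  simp [cst, scal, ← map_mul]

lemma cst_apply (x : KAlg k V) : cst k V x = toX k V (x ⊗ₜ 1) := rfl

lemma scal_apply (p : Polynomial k) : scal k V p = toX k V (1 ⊗ₜ p) := rfl

lemma scal_comm (p : Polynomial k) (x : KX k V) : scal k V p * x = x * scal k V p := by
  obtain ⟨x, rfl⟩ := (toX k V).surjective x
  induction x using TensorProduct.induction_on with
  | zero => simp
  | add x y hx hy => simp only [map_add, mul_add, add_mul, hx, hy]
  | tmul a q => simp [scal_apply, ← map_mul, mul_comm p]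

@[elab_as_elim]
lemma KX_induction {P : KX k V → Prop} (x : KX k V) (zero : P 0) (add : ∀ x y, P x → P y → P (x + y))
    (mul : ∀ a p, P (cst k V a * scal k V p)) : P x := by
  obtain ⟨x, rfl⟩ := (toX k V).surjective x
  induction x using TensorProduct.induction_on with
  | zero => simpa using zero
  | add x y hx hy => rw [map_add]; exact add _ _ hx hy
  | tmul a q => rw [← cst_mul_scal]; exact mul _ _

lemma cst_central {c : KAlg k V} (h : ∀ x, c * x = x * c) (x : KX k V) :
    cst k V c * x = x * cst k V c := by
  induction x using KX_induction with
  | zero => simp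
  | add x y hx hy => simp only [mul_add, add_mul, hx, hy]
  | mul a q => rw [← mul_assoc, ← map_mul, h, map_mul, mul_assoc, mul_assoc, scal_comm]

lemma dX_cst_mul_scal (x : KAlg k V) (p : Polynomial k) :
    dX k V (cst k V x * scal k V p) = cst k V (dAlg k V x) * scal k V p := by
  simp [cst_mul_scal, dX]

lemma derX_cst_mul_scal (x : KAlg k V) (p : Polynomial k) :
    derX k V (cst k V x * scal k V p) = cst k V x * scal k V (Polynomial.derivative p) := by
  simp [cst_mul_scal, derX]

lemma integX_cst_mul_scal (x : KAlg k V) (p : Polynomial k) :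
    integX k V (cst k V x * scal k V p) = integ k p • x := by
  simp [cst_mul_scal, integX]

lemma evalX_cst (c : k) (x : KAlg k V) : evalX k V c (cst k V x) = x := by
  simp [evalX, cst_apply]

lemma evalX_scal (c : k) (p : Polynomial k) :
    evalX k V c (scal k V p) = algebraMap k _ (p.eval c) := by
  simp [evalX, scal_apply, Algebra.algebraMap_eq_smul_one, Polynomial.aeval_def, Polynomial.eval₂_eq_eval_map]

lemma dX_mul_scal (x : KX k V) (p : Polynomial k) :
    dX k V (x * scal k V p) = dX k V x * scal k V p := by
  induction x using KX_induction with
  | zero => simp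
  | add x y hx hy => simp only [map_add, add_mul, hx, hy]
  | mul a q => rw [mul_assoc, ← map_mul, dX_cst_mul_scal, dX_cst_mul_scal, map_mul, mul_assoc]

lemma dX_cst (x : KAlg k V) : dX k V (cst k V x) = cst k V (dAlg k V x) := by
  simpa using dX_cst_mul_scal x 1

lemma dX_one : dX k V 1 = 0 := by
  simpa [dAlg_one] using dX_cst (1 : KAlg k V)

lemma dX_cst_inclL_mul (a : A k V) (x : KX k V) :
    dX k V (cst k V (inclL k V a) * x) = cst k V (inclL k V a) * dX k V x := by
  induction x using KX_induction with
  | zero => simp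
  | add x y hx hy => simp only [map_add, mul_add, hx, hy]
  | mul b q =>
    rw [← mul_assoc, ← map_mul, dX_cst_mul_scal, dX_cst_mul_scal, dAlg_inclL_mul, map_mul, mul_assoc]

lemma dX_cst_inclR_mul (a : A k V) (x : KX k V) :
    dX k V (cst k V (inclR k V a) * x) = cst k V (inclR k V a) * dX k V x := by
  induction x using KX_induction with
  | zero => simp
  | add x y hx hy => simp only [map_add, mul_add, hx, hy]
  | mul b q =>
    rw [← mul_assoc, ← map_mul, inclR_comm, dX_cst_mul_scal, dX_cst_mul_scal, dAlg_mul_inclR,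
      ← mul_assoc, ← map_mul, inclR_comm]

lemma dX_cst_ι_mul (u : V) (x : KX k V) :
    dX k V (cst k V (inclW k V (ExteriorAlgebra.ι k u)) * x) = cst k V (diffLR k V u) * x -
      cst k V (inclW k V (ExteriorAlgebra.ι k u)) * dX k V x := by
  induction x using KX_induction with
  | zero => simp
  | add x y hx hy => simp only [mul_add, map_add, hx, hy]; abel
  | mul a q =>
    rw [← mul_assoc, ← map_mul, dX_cst_mul_scal, dX_cst_mul_scal, dAlg_inclW_ι_mul']
    simp only [map_sub, map_mul, sub_mul, mul_assoc]

lemma derX_mul (x y : KX k V) : derX k V (x * y) = derX k V x * y + x * derX k V y := by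
  induction x using KX_induction with
  | zero => simp
  | add x y hx hy => simp only [add_mul, map_add, hx, hy]; abel
  | mul a p =>
    induction y using KX_induction with
    | zero => simp
    | add x y hx hy => simp only [mul_add, map_add, hx, hy]; abel
    | mul b q =>
      have h : ∀ r s, cst k V a * scal k V r * (cst k V b * scal k V s) =
          cst k V (a * b) * scal k V (r * s) := by
        intro r s
        rw [mul_assoc, ← mul_assoc (scal k V r), scal_comm, map_mul, map_mul]; simp only [mul_assoc]
      rw [h, derX_cst_mul_scal, derX_cst_mul_scal, derX_cst_mul_scal, h, h, Polynomial.derivative_mul,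
        map_add, mul_add]

lemma derX_cst (x : KAlg k V) : derX k V (cst k V x) = 0 := by
  simpa using derX_cst_mul_scal x 1

lemma derX_one : derX k V 1 = 0 := by simpa using derX_cst (1 : KAlg k V)

lemma dAlg_integX (x : KX k V) : dAlg k V (integX k V x) = integX k V (dX k V x) := by
  induction x using KX_induction with
  | zero => simp
  | add x y hx hy => simp only [map_add, hx, hy]
  | mul a p => rw [dX_cst_mul_scal, integX_cst_mul_scal, integX_cst_mul_scal, map_smul]

lemma integX_cst_mul (a : KAlg k V) (x : KX k V) :
    integX k V (cst k V a * x) = a * integX k V x := by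
  induction x using KX_induction with
  | zero => simp
  | add x y hx hy => simp only [map_add, mul_add, hx, hy]
  | mul b p =>
    rw [← mul_assoc, ← map_mul, integX_cst_mul_scal, integX_cst_mul_scal, mul_smul_comm]

lemma integX_mul_cst (a : KAlg k V) (x : KX k V) :
    integX k V (x * cst k V a) = integX k V x * a := by
  induction x using KX_induction with
  | zero => simp
  | add x y hx hy => simp only [map_add, add_mul, hx, hy]
  | mul b p =>
    rw [mul_assoc, scal_comm, ← mul_assoc, ← map_mul, integX_cst_mul_scal, integX_cst_mul_scal,
      smul_mul_assoc]

lemma integ_derivative [CharZero k] (p : Polynomial k) :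
    integ k (Polynomial.derivative p) = p.eval 1 - p.eval 0 := by
  induction p using Polynomial.induction_on' with
  | add p q hp hq => simp only [map_add, hp, hq, Polynomial.eval_add]; ring
  | monomial n a =>
    rw [Polynomial.derivative_monomial]
    cases n with
    | zero => simp
    | succ n =>
      have : (n : k) + 1 ≠ 0 := Nat.cast_add_one_ne_zero n
      simp [integ, Polynomial.lsum_apply]
      field_simp

/-- The fundamental theorem of calculus. -/
lemma integX_derX [CharZero k] (x : KX k V) :
    integX k V (derX k V x) = evalX k V 1 x - evalX k V 0 x := by
  induction x using KX_induction with
  | zero => simp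
  | add x y hx hy => simp only [map_add, hx, hy]; abel
  | mul a p =>
    rw [derX_cst_mul_scal, integX_cst_mul_scal, integ_derivative, map_mul, map_mul]
    simp only [evalX_cst, evalX_scal, sub_smul, Algebra.algebraMap_eq_smul_one, mul_smul_comm, mul_one]

/-! ### The path between the two copies of `A`, and the derivation along it. -/

variable (k V) in
/-- `v ↦ v ⊗ 1 X + 1 ⊗ v (1 - X)`, with values in the centre. -/
def interpV : V →ₗ[k] Subalgebra.center k (KX k V) where
  toFun v := ⟨cst k V (inclL k V (SymmetricAlgebra.ι k V v)) * scal k V Polynomial.X +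
    cst k V (inclR k V (SymmetricAlgebra.ι k V v)) * scal k V (1 - Polynomial.X), by
      rw [Subalgebra.mem_center_iff]
      intro x
      simp only [mul_add, add_mul, mul_assoc, scal_comm]
      simp only [← mul_assoc, cst_central (inclL_comm _), cst_central (inclR_comm _)]⟩
  map_add' v w := by
    ext
    simp only [map_add, add_mul, Subalgebra.coe_add]
    abel
  map_smul' c v := by
    ext
    simp

variable (k V) in
/-- The algebra map `A → K[X]`, `v ↦ v ⊗ 1 X + 1 ⊗ v (1 - X)`. -/
def interp : A k V →ₐ[k] KX k V :=
  -- The universal property of `A` needs a commutative target, hence the passage through the centre.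
  (Subalgebra.center k (KX k V)).val.comp (SymmetricAlgebra.lift (interpV k V))

lemma interp_ι (v : V) : interp k V (SymmetricAlgebra.ι k V v) =
    cst k V (inclL k V (SymmetricAlgebra.ι k V v)) * scal k V Polynomial.X +
      cst k V (inclR k V (SymmetricAlgebra.ι k V v)) * scal k V (1 - Polynomial.X) := by
  simp [interp, interpV]

lemma interp_comm (a : A k V) (x : KX k V) : interp k V a * x = x * interp k V a :=
  (Subalgebra.mem_center_iff.1 (SymmetricAlgebra.lift (interpV k V) a).2 x).symm

/-- The algebra map `Λ V → K[X]`, `v ↦ v p`. -/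
def scaleW (p : Polynomial k) : ExteriorAlgebra k V →ₐ[k] KX k V :=
  ExteriorAlgebra.lift k ⟨LinearMap.mulRight k (scal k V p) ∘ₗ (cst k V).toLinearMap ∘ₗ
    (inclW k V).toLinearMap ∘ₗ ExteriorAlgebra.ι k, by
      intro v
      simp only [LinearMap.comp_apply, LinearMap.mulRight_apply, AlgHom.toLinearMap_apply]
      rw [mul_assoc, scal_comm, ← mul_assoc, ← mul_assoc, ← map_mul, ← map_mul,
        ExteriorAlgebra.ι_sq_zero]
      simp⟩

lemma scaleW_ι (p : Polynomial k) (v : V) : scaleW p (ExteriorAlgebra.ι k v) =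
    cst k V (inclW k V (ExteriorAlgebra.ι k v)) * scal k V p := by
  simp [scaleW]

variable (k V) in
/-- The derivation `A → K[X]` over `interp` that sends `v ∈ V` to `1 ⊗ v ⊗ 1`. -/
def derInterp : A k V →ₗ[k] KX k V :=
  TensorProduct.lift ((LinearMap.mul k (KX k V)).compl₁₂ (interp k V).toLinearMap
    ((cst k V).toLinearMap ∘ₗ (inclW k V).toLinearMap ∘ₗ ExteriorAlgebra.ι k)) ∘ₗ univD

lemma derInterp_ι (v : V) : derInterp k V (SymmetricAlgebra.ι k V v) =
    cst k V (inclW k V (ExteriorAlgebra.ι k v)) := by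
  simp [derInterp, univD_ι]

lemma derInterp_one : derInterp k V 1 = 0 := by
  simp [derInterp, univD_one]

lemma derInterp_mul (a b : A k V) : derInterp k V (a * b) =
    interp k V a * derInterp k V b + interp k V b * derInterp k V a := by
  -- The map `A ⊗ V → K[X]` is linear over `interp`, so it carries the Leibniz rule of `univD` to
  -- that of `derInterp`.
  have h : ∀ (a : A k V) (x : A k V ⊗[k] V),
      TensorProduct.lift ((LinearMap.mul k (KX k V)).compl₁₂ (interp k V).toLinearMap
      ((cst k V).toLinearMap ∘ₗ (inclW k V).toLinearMap ∘ₗ ExteriorAlgebra.ι k)) (a • x) =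
      interp k V a * TensorProduct.lift ((LinearMap.mul k (KX k V)).compl₁₂
        (interp k V).toLinearMap
        ((cst k V).toLinearMap ∘ₗ (inclW k V).toLinearMap ∘ₗ ExteriorAlgebra.ι k)) x := by
    intro a x
    induction x using TensorProduct.induction_on with
    | zero => simp
    | add x y hx hy => simp only [smul_add, map_add, mul_add, hx, hy]
    | tmul b v => simp [TensorProduct.smul_tmul', mul_assoc]
  rw [derInterp, LinearMap.comp_apply, univD_mul, map_add, h, h]
  rfl

/-- The values of `interp` are polynomials in the two central degree zero copies of `A`, and `d` is
linear over these. -/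
lemma dX_interp_mul (a : A k V) (x : KX k V) :
    dX k V (interp k V a * x) = interp k V a * dX k V x := by
  induction a using SymmetricAlgebra.induction generalizing x with
  | algebraMap r => simp [Algebra.algebraMap_eq_smul_one]
  | ι v =>
    rw [interp_ι, add_mul, map_add, mul_assoc, mul_assoc, dX_cst_inclL_mul, dX_cst_inclR_mul,
      scal_comm, scal_comm, dX_mul_scal, dX_mul_scal, ← scal_comm, ← scal_comm]
    simp only [add_mul, mul_assoc]
  | mul a b ha hb => rw [map_mul (interp k V), mul_assoc, ha, hb, mul_assoc]
  | add a b ha hb => simp only [map_add, add_mul, ha, hb]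

lemma derInterp_induction {P : KX k V → Prop} (b : A k V) (zero : P 0)
    (add : ∀ x y, P x → P y → P (x + y))
    (mul : ∀ a v, P (interp k V a * cst k V (inclW k V (ExteriorAlgebra.ι k v)))) :
    P (derInterp k V b) := by
  rw [derInterp, LinearMap.comp_apply]
  induction univD (k := k) (V := V) b using TensorProduct.induction_on with
  | zero => simpa using zero
  | add x y hx hy => rw [map_add]; exact add _ _ hx hy
  | tmul a v => exact mul a v

/-- Both sides are derivations over `interp`, so they need only agree on `V`. There `d(1 ⊗ v ⊗ 1) =
v ⊗ 1 - 1 ⊗ v` is the velocity of the segment. This makes `D` an infinitesimal homotopy along the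
path. -/
lemma dX_derInterp (a : A k V) : dX k V (derInterp k V a) = derX k V (interp k V a) := by
  induction a using SymmetricAlgebra.induction with
  | algebraMap r => simp [Algebra.algebraMap_eq_smul_one, derInterp_one, derX_one]
  | ι v =>
    rw [derInterp_ι, interp_ι, map_add, derX_cst_mul_scal, derX_cst_mul_scal]
    have := dX_cst_ι_mul v (1 : KX k V)
    simp only [mul_one, dX_one, mul_zero, sub_zero] at this
    rw [this, diffLR_apply, map_sub]
    simp [sub_eq_add_neg]
  | mul a b ha hb =>
    rw [derInterp_mul, map_mul, map_add, dX_interp_mul, dX_interp_mul, ha, hb, derX_mul,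
      interp_comm b, add_comm]
  | add a b ha hb => simp only [map_add, ha, hb]

/-- `D a` is a combination of vectors with coefficients from `interp`, hence has exterior degree
one; this is the superderivation rule for such a factor. -/
lemma dX_derInterp_mul (a : A k V) (x : KX k V) : dX k V (derInterp k V a * x) =
    derX k V (interp k V a) * x - derInterp k V a * dX k V x := by
  rw [← dX_derInterp]
  refine derInterp_induction (P := fun y => dX k V (y * x) = dX k V y * x - y * dX k V x) a
    (by simp) (fun x y hx hy => ?_) fun a v => ?_
  · simp only [add_mul, map_add, hx, hy]; abel
  · have := dX_cst_ι_mul v (1 : KX k V)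
    simp only [mul_one, dX_one, mul_zero, sub_zero] at this
    rw [mul_assoc, dX_interp_mul, dX_cst_ι_mul, dX_interp_mul, this]
    simp only [mul_sub, mul_assoc]

lemma dX_scaleW_ι_mul (p : Polynomial k) (u : V) (x : KX k V) :
    dX k V (scaleW p (ExteriorAlgebra.ι k u) * x) =
      cst k V (diffLR k V u) * scal k V p * x - scaleW p (ExteriorAlgebra.ι k u) * dX k V x := by
  rw [scaleW_ι, mul_assoc, dX_cst_ι_mul, scal_comm, dX_mul_scal, ← scal_comm, ← scal_comm]
  simp only [mul_assoc]

lemma dX_scaleW_mul (p : Polynomial k) (ω : ExteriorAlgebra k V) (x : KX k V) :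
    dX k V (scaleW p ω * x) = dX k V (scaleW p ω) * x + scaleW p (sgnW k V ω) * dX k V x := by
  induction ω using ext_induction generalizing x with
  | one => simp [dX_one]
  | add x y hx hy => simp only [add_mul, map_add, hx, hy]; abel
  | smul c x hx => simp only [smul_mul_assoc, map_smul, hx, smul_add]
  | ι_mul u ω ih =>
    rw [map_mul (scaleW p), mul_assoc, dX_scaleW_ι_mul, ih, dX_scaleW_ι_mul, map_mul (sgnW k V),
      sgnW_ι, map_mul (scaleW p)]
    simp only [map_neg, mul_add, sub_mul, neg_mul, mul_assoc]
    abel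

lemma cst_ι_mul_scaleW_ι (p : Polynomial k) (u v : V) :
    cst k V (inclW k V (ExteriorAlgebra.ι k v)) * scaleW p (ExteriorAlgebra.ι k u) =
      - (scaleW p (ExteriorAlgebra.ι k u) * cst k V (inclW k V (ExteriorAlgebra.ι k v))) := by
  rw [scaleW_ι, ← mul_assoc, mul_assoc _ (scal k V p), scal_comm, ← mul_assoc, ← neg_mul,
    ← map_mul (cst k V), ← map_mul (inclW k V), ← map_mul (cst k V), ← map_mul (inclW k V),
    ← map_neg (cst k V), ← map_neg (inclW k V)]
  congr 3
  exact eq_neg_of_add_eq_zero_left (ExteriorAlgebra.ι_add_mul_swap v u)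

lemma derInterp_mul_scaleW_ι (p : Polynomial k) (a : A k V) (u : V) :
    derInterp k V a * scaleW p (ExteriorAlgebra.ι k u) =
      - (scaleW p (ExteriorAlgebra.ι k u) * derInterp k V a) := by
  refine derInterp_induction (P := fun y => y * scaleW p (ExteriorAlgebra.ι k u) =
    - (scaleW p (ExteriorAlgebra.ι k u) * y)) a (by simp) (fun x y hx hy => ?_) fun a v => ?_
  · simp only [mul_add, add_mul, hx, hy]; abel
  · rw [mul_assoc, cst_ι_mul_scaleW_ι, ← mul_assoc, ← interp_comm]
    simp [mul_assoc]

/-- `D a` has exterior degree one, so moving it past `ω` costs `(-1)^|ω|`, which `sgnW` cancels. The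
same sign occurs in the differential of `K ⊗_A K`. -/
lemma derInterp_mul_scaleW_sgnW (p : Polynomial k) (a : A k V) (ω : ExteriorAlgebra k V) :
    derInterp k V a * scaleW p (sgnW k V ω) = scaleW p ω * derInterp k V a := by
  induction ω using ext_induction with
  | one => simp
  | add x y hx hy => simp only [mul_add, add_mul, map_add, hx, hy]
  | smul c x hx => simp only [smul_mul_assoc, map_smul, mul_smul_comm, hx]
  | ι_mul u ω ih =>
    rw [map_mul (sgnW k V), map_mul, sgnW_ι, map_neg, ← mul_assoc, mul_neg, derInterp_mul_scaleW_ι,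
      neg_neg, mul_assoc, ih, map_mul, mul_assoc]

lemma evalX_one_interp (a : A k V) : evalX k V 1 (interp k V a) = inclL k V a := by
  induction a using SymmetricAlgebra.induction with
  | algebraMap r => simp
  | ι v => simp [interp_ι, evalX_cst, evalX_scal]
  | mul a b ha hb => simp only [map_mul, ha, hb]
  | add a b ha hb => simp only [map_add, ha, hb]

lemma evalX_zero_interp (a : A k V) : evalX k V 0 (interp k V a) = inclR k V a := by
  induction a using SymmetricAlgebra.induction with
  | algebraMap r => simp
  | ι v => simp [interp_ι, evalX_cst, evalX_scal]
  | mul a b ha hb => simp only [map_mul, ha, hb]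
  | add a b ha hb => simp only [map_add, ha, hb]

lemma evalX_scaleW_of_eval_eq_one {c : k} {p : Polynomial k} (h : p.eval c = 1)
    (ω : ExteriorAlgebra k V) : evalX k V c (scaleW p ω) = inclW k V ω := by
  have : (evalX k V c).comp (scaleW p) = inclW k V := by
    ext v; simp [scaleW_ι, evalX_cst, evalX_scal, h]
  exact DFunLike.congr_fun this ω

/-- Where `p` vanishes every vector is killed and only the degree zero part of `ω` is left. This is
how the augmentation `μ` appears at the ends of the interval. -/
lemma evalX_scaleW_of_eval_eq_zero {c : k} {p : Polynomial k} (h : p.eval c = 0)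
    (ω : ExteriorAlgebra k V) :
    evalX k V c (scaleW p ω) = algebraMap k _ (ExteriorAlgebra.algebraMapInv ω) := by
  have : (evalX k V c).comp (scaleW p) =
      (Algebra.ofId k (KAlg k V)).comp (ExteriorAlgebra.algebraMapInv (R := k) (M := V)) := by
    ext v; simp [scaleW_ι, evalX_cst, evalX_scal, h, ExteriorAlgebra.algebraMapInv]
  exact DFunLike.congr_fun this ω

end KoszulSym
end

/-! ### The form `θ` on `K ⊗_A K` and its integral. -/

noncomputable section
namespace KoszulSym
variable (k V : Type*) [Field k] [AddCommGroup V] [Module k V]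

/-- The bilinear map `(x, y) ↦ θ (x ⊗ y)` with
`θ ((a ⊗ ω ⊗ b) ⊗ (c ⊗ η ⊗ e)) = a D(b c) ω(1 - X) η(X) e`, where `ω(p)` is `scaleW p ω` and
`D` is `derInterp`: here the part that depends on the first factor and on `c`. -/
def homotopyLeft : K k V →ₗ[k] A k V →ₗ[k] KX k V :=
  TensorProduct.lift <| LinearMap.mk₂ k
    (fun a y => LinearMap.llcomp k (A k V) (KX k V) (KX k V)
      (LinearMap.mulLeft k (cst k V (inclL k V a)))
      (TensorProduct.lift (LinearMap.mk₂ k (fun ω b =>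
        LinearMap.mulRight k (scaleW (1 - Polynomial.X) ω) ∘ₗ derInterp k V ∘ₗ LinearMap.mulLeft k b)
        (fun ω ω' b => by ext; simp [mul_add]) (fun c ω b => by ext; simp)
        (fun ω b b' => by ext; simp [add_mul]) (fun c ω b => by ext; simp)) y))
    (fun a a' y => by ext; simp [add_mul]) (fun c a y => by ext; simp)
    (fun a y y' => by ext; simp) (fun c a y => by ext; simp)

/-- The part of `θ` that depends on the second factor `c ⊗ η ⊗ e`, except for `c`. -/
def homotopyRight : ExteriorAlgebra k V ⊗[k] A k V →ₗ[k] KX k V :=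
  TensorProduct.lift ((LinearMap.mul k (KX k V)).compl₁₂ (scaleW Polynomial.X).toLinearMap
    ((cst k V).toLinearMap ∘ₗ (inclR k V).toLinearMap))

/-- The map `θ : K ⊗_k K → K[X]` with
`θ ((a ⊗ ω ⊗ b) ⊗ (c ⊗ η ⊗ e)) = a D(b c) ω(1 - X) η(X) e`. -/
def homotopyForm : K k V ⊗[k] K k V →ₗ[k] KX k V :=
  TensorProduct.lift <| LinearMap.mk₂ k
    (fun x y => TensorProduct.lift ((LinearMap.mul k (KX k V)).compl₁₂ (homotopyLeft k V x)
      (homotopyRight k V)) y)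
    (fun x x' y => by
      induction y using TensorProduct.induction_on with
      | zero => simp
      | add y y' hy hy' => simp only [map_add] at hy hy' ⊢; rw [hy, hy']; abel
      | tmul a y => simp)
    (fun c x y => by
      induction y using TensorProduct.induction_on with
      | zero => simp
      | add y y' hy hy' => simp only [map_add, hy, hy', smul_add]
      | tmul a y => simp)
    (fun x y y' => by simp) (fun c x y => by simp)

variable {k V}

lemma homotopyLeft_tmul (a b c : A k V) (ω : ExteriorAlgebra k V) :
    homotopyLeft k V (a ⊗ₜ (ω ⊗ₜ b)) c =
      cst k V (inclL k V a) * (derInterp k V (b * c) * scaleW (1 - Polynomial.X) ω) := rfl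

lemma homotopyForm_tmul (x : K k V) (c e : A k V) (η : ExteriorAlgebra k V) :
    homotopyForm k V (x ⊗ₜ (c ⊗ₜ (η ⊗ₜ e))) =
      homotopyLeft k V x c * (scaleW Polynomial.X η * cst k V (inclR k V e)) := rfl

/-- The inner factors `b` and `c` enter only through the product `b c` inside `D`. -/
lemma homotopyForm_balanced (a : A k V) (x y : K k V) :
    homotopyForm k V (ract k V a x ⊗ₜ y) = homotopyForm k V (x ⊗ₜ lact k V a y) := by
  induction y using K_induction with
  | zero => simp
  | add y y' hy hy' => simp only [TensorProduct.tmul_add, map_add, hy, hy']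
  | tmul c η e =>
    rw [lact_tmul, homotopyForm_tmul, homotopyForm_tmul]
    congr 1
    induction x using K_induction with
    | zero => simp
    | add x x' hx hx' => simp only [map_add, LinearMap.add_apply, hx, hx']
    | tmul a' ω b => rw [ract_tmul, homotopyLeft_tmul, homotopyLeft_tmul, mul_assoc]

variable (k V) in
/-- The contracting homotopy `φ`, the integral of `homotopyForm` over `[0, 1]`. -/
def homotopy : KK k V →ₗ[k] K k V :=
  (toAlg k V).symm.toLinearMap ∘ₗ integX k V ∘ₗ
    BalTensor.lift (ract k V) (lact k V) (homotopyForm k V) homotopyForm_balanced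

lemma toAlg_homotopy (x y : K k V) :
    toAlg k V (homotopy k V (tmulA x y)) = integX k V (homotopyForm k V (x ⊗ₜ y)) := by
  simp [homotopy, tmulA]

lemma homotopyLeft_lact (a c : A k V) (x : K k V) :
    homotopyLeft k V (lact k V a x) c = cst k V (inclL k V a) * homotopyLeft k V x c := by
  induction x using K_induction with
  | zero => simp
  | add x x' hx hx' => simp only [map_add, LinearMap.add_apply, hx, hx', mul_add]
  | tmul a' ω b =>
    rw [lact_tmul, homotopyLeft_tmul, homotopyLeft_tmul, map_mul, map_mul, mul_assoc]

lemma homotopyForm_lact (a : A k V) (x y : K k V) :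
    homotopyForm k V (lact k V a x ⊗ₜ y) =
      cst k V (inclL k V a) * homotopyForm k V (x ⊗ₜ y) := by
  induction y using K_induction with
  | zero => simp
  | add y y' hy hy' => simp only [TensorProduct.tmul_add, map_add, hy, hy', mul_add]
  | tmul c η e =>
    rw [homotopyForm_tmul, homotopyForm_tmul, homotopyLeft_lact, mul_assoc]

lemma homotopyForm_ract (a : A k V) (x y : K k V) :
    homotopyForm k V (x ⊗ₜ ract k V a y) =
      homotopyForm k V (x ⊗ₜ y) * cst k V (inclR k V a) := by
  induction y using K_induction with
  | zero => simp
  | add y y' hy hy' => simp only [TensorProduct.tmul_add, map_add, hy, hy', add_mul]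
  | tmul c η e =>
    rw [ract_tmul, homotopyForm_tmul, homotopyForm_tmul, map_mul, map_mul]
    simp only [mul_assoc]

lemma homotopy_isBilin : IsBilin (homotopy k V) := by
  constructor
  · intro a x y
    apply (toAlg k V).injective
    rw [toAlg_homotopy, homotopyForm_lact, integX_cst_mul, toAlg_lact, toAlg_homotopy]
  · intro a x y
    apply (toAlg k V).injective
    rw [toAlg_homotopy, homotopyForm_ract, integX_mul_cst, toAlg_ract, toAlg_homotopy]

/-- The linear map `a ⊗ ω ⊗ c ↦ a D(c b) ω(1 - X)`. -/
def leftFactor (b : A k V) : KAlg k V →ₗ[k] KX k V :=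
  (homotopyLeft k V).flip b ∘ₗ (toAlg k V).symm.toLinearMap

/-- The linear map `c ⊗ η ⊗ e ↦ D(b c) η(X) e`. -/
def rightFactor (b : A k V) : KAlg k V →ₗ[k] KX k V :=
  homotopyForm k V ∘ₗ TensorProduct.mk k (K k V) (K k V) (1 ⊗ₜ (1 ⊗ₜ b)) ∘ₗ
    (toAlg k V).symm.toLinearMap

lemma leftFactor_mul (a b c : A k V) (ω : ExteriorAlgebra k V) :
    leftFactor b (inclL k V a * (inclW k V ω * inclR k V c)) =
      cst k V (inclL k V a) * (derInterp k V (c * b) * scaleW (1 - Polynomial.X) ω) := by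
  rw [← mul_assoc, ← toAlg_tmul]
  simp [leftFactor, homotopyLeft_tmul]

lemma rightFactor_mul (b c e : A k V) (ω : ExteriorAlgebra k V) :
    rightFactor b (inclL k V c * (inclW k V ω * inclR k V e)) =
      derInterp k V (b * c) * (scaleW Polynomial.X ω * cst k V (inclR k V e)) := by
  rw [← mul_assoc, ← toAlg_tmul]
  simp [rightFactor, homotopyLeft_tmul, homotopyForm_tmul]

/-- The sign arises because `ω(1 - X)` stands behind `D`, which has degree one: the new vector has
to pass it to reach the front. -/
lemma leftFactor_ι_mul (b : A k V) (u : V) (x : KAlg k V) :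
    leftFactor b (inclW k V (ExteriorAlgebra.ι k u) * x) =
      -(scaleW (1 - Polynomial.X) (ExteriorAlgebra.ι k u) * leftFactor b x) := by
  induction x using KAlg_induction with
  | zero => simp
  | add x y hx hy => simp only [mul_add, map_add, hx, hy]; abel
  | mul a ω c =>
    have h : inclW k V (ExteriorAlgebra.ι k u) * (inclL k V a * (inclW k V ω * inclR k V c)) =
        inclL k V a * (inclW k V (ExteriorAlgebra.ι k u * ω) * inclR k V c) := by
      rw [map_mul, ← mul_assoc, ← inclL_comm]; simp only [mul_assoc]
    rw [h, leftFactor_mul, leftFactor_mul, map_mul (scaleW _), ← mul_assoc (derInterp _ _ _),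
      derInterp_mul_scaleW_ι, ← mul_assoc (scaleW _ _), ← cst_central (inclL_comm a)]
    simp only [neg_mul, mul_neg, mul_assoc]

lemma rightFactor_ι_mul (b : A k V) (u : V) (x : KAlg k V) :
    rightFactor b (inclW k V (ExteriorAlgebra.ι k u) * x) =
      -(scaleW Polynomial.X (ExteriorAlgebra.ι k u) * rightFactor b x) := by
  induction x using KAlg_induction with
  | zero => simp
  | add x y hx hy => simp only [mul_add, map_add, hx, hy]; abel
  | mul a ω c =>
    have h : inclW k V (ExteriorAlgebra.ι k u) * (inclL k V a * (inclW k V ω * inclR k V c)) =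
        inclL k V a * (inclW k V (ExteriorAlgebra.ι k u * ω) * inclR k V c) := by
      rw [map_mul, ← mul_assoc, ← inclL_comm]; simp only [mul_assoc]
    rw [h, rightFactor_mul, rightFactor_mul, map_mul (scaleW _), mul_assoc (scaleW _ _),
      ← mul_assoc (derInterp _ _ _), derInterp_mul_scaleW_ι]
    simp only [neg_mul, mul_assoc]

/-- The distance from the point `X` to the end `X = 1` of the segment is `1 - X`, and to the end `X
= 0` it is `X`. This is why `ω` is scaled by `1 - X` and `η` by `X`. -/
lemma cst_inclL_sub_interp (u : V) :
    cst k V (inclL k V (SymmetricAlgebra.ι k V u)) - interp k V (SymmetricAlgebra.ι k V u) =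
      cst k V (diffLR k V u) * scal k V (1 - Polynomial.X) := by
  rw [interp_ι, diffLR_apply, map_sub, map_sub, map_one]
  simp only [mul_sub, sub_mul, mul_one]; abel

lemma interp_sub_cst_inclR (u : V) :
    interp k V (SymmetricAlgebra.ι k V u) - cst k V (inclR k V (SymmetricAlgebra.ι k V u)) =
      cst k V (diffLR k V u) * scal k V Polynomial.X := by
  rw [interp_ι, diffLR_apply, map_sub, map_sub, map_one]
  simp only [mul_sub, sub_mul, mul_one]; abel

lemma derX_scaleW_ι (p : Polynomial k) (u : V) : derX k V (scaleW p (ExteriorAlgebra.ι k u)) =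
    cst k V (inclW k V (ExteriorAlgebra.ι k u)) * scal k V (Polynomial.derivative p) := by
  rw [scaleW_ι, derX_cst_mul_scal]

/-- In `d ω` a coefficient `v ⊗ 1` stays outside, while `1 ⊗ v` joins `b` inside `D`. By the Leibniz
rule, `(v ⊗ 1) D(b) - D(v b)` equals `(1 - X) (v ⊗ 1 - 1 ⊗ v) D(b) - interp(b) (1 ⊗ v ⊗ 1)`. The
first part rebuilds the differential of `ω(1 - X)`; the second, with the `-1` that is the derivative
of `1 - X`, rebuilds its derivative. -/
lemma leftFactor_dAlg (b : A k V) (ω : ExteriorAlgebra k V) :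
    leftFactor b (dAlg k V (inclW k V ω)) =
      derInterp k V b * dX k V (scaleW (1 - Polynomial.X) ω) +
        interp k V b * derX k V (scaleW (1 - Polynomial.X) ω) := by
  induction ω using ext_induction with
  | one => simp [dAlg_one, dX_one, derX_one]
  | add x y hx hy => simp only [map_add, hx, hy, mul_add]; abel
  | smul c x hx => simp only [map_smul, hx, mul_smul_comm, smul_add]
  | ι_mul u ω ih =>
    have h1 : leftFactor b (inclL k V (SymmetricAlgebra.ι k V u) * inclW k V ω) =
        cst k V (inclL k V (SymmetricAlgebra.ι k V u)) *
          (derInterp k V b * scaleW (1 - Polynomial.X) ω) := by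
      simpa using leftFactor_mul (SymmetricAlgebra.ι k V u) b 1 ω
    have h2 : leftFactor b (inclR k V (SymmetricAlgebra.ι k V u) * inclW k V ω) =
        derInterp k V (SymmetricAlgebra.ι k V u * b) * scaleW (1 - Polynomial.X) ω := by
      rw [inclR_comm]
      simpa using leftFactor_mul 1 b (SymmetricAlgebra.ι k V u) ω
    have h3 : leftFactor b (diffLR k V u * inclW k V ω) =
        derInterp k V b * (cst k V (diffLR k V u) * scal k V (1 - Polynomial.X) *
          scaleW (1 - Polynomial.X) ω) - interp k V b * (cst k V (inclW k V (ExteriorAlgebra.ι k u)) *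
            scaleW (1 - Polynomial.X) ω) := by
      rw [← cst_inclL_sub_interp, diffLR_apply, sub_mul, map_sub, h1, h2, derInterp_mul, derInterp_ι]
      simp only [sub_mul, mul_sub, add_mul, ← mul_assoc, ← interp_comm,
        ← cst_central (inclL_comm (SymmetricAlgebra.ι k V u))]
      abel
    rw [dAlg_inclW_ι_mul, map_sub, leftFactor_ι_mul, ih, h3, map_mul (scaleW _),
      dX_scaleW_ι_mul, derX_mul, derX_scaleW_ι]
    simp only [map_sub, Polynomial.derivative_one, Polynomial.derivative_X, zero_sub, map_neg,
      map_one, mul_add, mul_sub, mul_neg, mul_one, neg_mul]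
    rw [← mul_assoc (derInterp k V b) (scaleW _ _), derInterp_mul_scaleW_ι,
      ← mul_assoc (interp k V b) (scaleW _ _), interp_comm b (scaleW _ _)]
    simp only [mul_assoc, neg_mul]
    abel

/-- The mirror image: `D(b v) - D(b) (1 ⊗ v)` equals `X (v ⊗ 1 - 1 ⊗ v) D(b) + interp(b) (1 ⊗ v ⊗
1)`, and `X` has derivative `1`. -/
lemma rightFactor_dAlg (b : A k V) (ω : ExteriorAlgebra k V) :
    rightFactor b (dAlg k V (inclW k V ω)) =
      derInterp k V b * dX k V (scaleW Polynomial.X ω) +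
        interp k V b * derX k V (scaleW Polynomial.X ω) := by
  induction ω using ext_induction with
  | one => simp [dAlg_one, dX_one, derX_one]
  | add x y hx hy => simp only [map_add, hx, hy, mul_add]; abel
  | smul c x hx => simp only [map_smul, hx, mul_smul_comm, smul_add]
  | ι_mul u ω ih =>
    have h1 : rightFactor b (inclL k V (SymmetricAlgebra.ι k V u) * inclW k V ω) =
        derInterp k V (b * SymmetricAlgebra.ι k V u) * scaleW Polynomial.X ω := by
      simpa using rightFactor_mul b (SymmetricAlgebra.ι k V u) 1 ω
    have h2 : rightFactor b (inclR k V (SymmetricAlgebra.ι k V u) * inclW k V ω) =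
        derInterp k V b * (scaleW Polynomial.X ω *
          cst k V (inclR k V (SymmetricAlgebra.ι k V u))) := by
      rw [inclR_comm]
      simpa using rightFactor_mul b 1 (SymmetricAlgebra.ι k V u) ω
    have h3 : rightFactor b (diffLR k V u * inclW k V ω) =
        derInterp k V b * (cst k V (diffLR k V u) * scal k V Polynomial.X *
          scaleW Polynomial.X ω) + interp k V b * (cst k V (inclW k V (ExteriorAlgebra.ι k u)) *
            scaleW Polynomial.X ω) := by
      rw [← interp_sub_cst_inclR, diffLR_apply, sub_mul, map_sub, h1, h2, derInterp_mul, derInterp_ι,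
        ← cst_central (inclR_comm (SymmetricAlgebra.ι k V u)), interp_comm (SymmetricAlgebra.ι k V u)]
      simp only [sub_mul, mul_sub, add_mul, mul_assoc]
      abel
    rw [dAlg_inclW_ι_mul, map_sub, rightFactor_ι_mul, ih, h3, map_mul (scaleW _),
      dX_scaleW_ι_mul, derX_mul, derX_scaleW_ι]
    simp only [Polynomial.derivative_X, map_one, mul_add, mul_sub, mul_one]
    rw [← mul_assoc (derInterp k V b) (scaleW _ _), derInterp_mul_scaleW_ι,
      ← mul_assoc (interp k V b) (scaleW _ _), interp_comm b (scaleW _ _)]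
    simp only [mul_assoc, neg_mul]
    abel

/-- The superderivation rule for `D(b) ω(1 - X) η(X)` gives the derivative of `interp b` and two
terms in which `d` meets `ω` or `η`. The terms from `leftFactor_dAlg` and `rightFactor_dAlg` cancel
these two and supply the other two summands of the product rule. -/
lemma dX_homotopyForm (b : A k V) (ω η : ExteriorAlgebra k V) :
    dX k V (derInterp k V b * (scaleW (1 - Polynomial.X) ω * scaleW Polynomial.X η)) +
      leftFactor b (dAlg k V (inclW k V ω)) * scaleW Polynomial.X η +
      scaleW (1 - Polynomial.X) ω * rightFactor b (dAlg k V (inclW k V η)) =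
    derX k V (interp k V b * (scaleW (1 - Polynomial.X) ω * scaleW Polynomial.X η)) := by
  rw [dX_derInterp_mul, dX_scaleW_mul, leftFactor_dAlg, rightFactor_dAlg, derX_mul, derX_mul]
  simp only [mul_add, add_mul, ← mul_assoc, derInterp_mul_scaleW_sgnW]
  rw [interp_comm b (scaleW (1 - Polynomial.X) ω)]
  simp only [mul_assoc]
  abel

/-! ### The homotopy identity. -/

/-- A bimodule map on `K ⊗_A K` is determined by its values on the `1 ⊗ ω ⊗ b ⊗ η ⊗ 1`. -/
lemma IsBilin.ext {f g : KK k V →ₗ[k] K k V} (hf : IsBilin f) (hg : IsBilin g)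
    (h : ∀ (ω η : ExteriorAlgebra k V) (b : A k V),
      f (tmulA (1 ⊗ₜ (ω ⊗ₜ b)) (1 ⊗ₜ (η ⊗ₜ 1))) = g (tmulA (1 ⊗ₜ (ω ⊗ₜ b)) (1 ⊗ₜ (η ⊗ₜ 1)))) :
    f = g := by
  ext w
  obtain ⟨w, rfl⟩ := BalTensor.mk_surjective _ _ w
  induction w using TensorProduct.induction_on with
  | zero => simp
  | add x y hx hy => simp only [map_add, hx, hy]
  | tmul x y =>
    change f (tmulA x y) = g (tmulA x y)
    induction x using K_induction with
    | zero => simp [tmulA]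
    | add x x' hx hx' =>
      have : tmulA (x + x') y = tmulA x y + tmulA x' y := by simp [tmulA, TensorProduct.add_tmul]
      rw [this, map_add, map_add, hx, hx']
    | tmul a ω b =>
      induction y using K_induction with
      | zero => simp [tmulA]
      | add y y' hy hy' =>
        have : ∀ x : K k V, tmulA x (y + y') = tmulA x y + tmulA x y' := by
          intro x; simp [tmulA, TensorProduct.tmul_add]
        rw [this, map_add, map_add, hy, hy']
      | tmul c η e =>
        have h1 : (a ⊗ₜ (ω ⊗ₜ b) : K k V) = lact k V a (1 ⊗ₜ (ω ⊗ₜ b)) := by simp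
        have h2 : (c ⊗ₜ (η ⊗ₜ e) : K k V) = ract k V e (lact k V c (1 ⊗ₜ (η ⊗ₜ 1))) := by simp
        rw [h1, h2, hf.1, hg.1, hf.2, hg.2, ← tmulA_balanced, ract_tmul, h]

lemma sgn_lact (a : A k V) (x : K k V) : sgn k V (lact k V a x) = lact k V a (sgn k V x) := by
  have : sgn k V ∘ₗ lact k V a = lact k V a ∘ₗ sgn k V := by ext; simp [sgn]
  exact LinearMap.congr_fun this x

lemma IsBilin.dK_add_dKK {f : KK k V →ₗ[k] K k V} (hf : IsBilin f) :
    IsBilin (dK k V ∘ₗ f + f ∘ₗ dKK k V) := by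
  constructor
  · intro a x y
    simp only [LinearMap.add_apply, LinearMap.comp_apply, dKK_tmulA, dK_lact, sgn_lact, map_add,
      hf.1]
  · intro a x y
    simp only [LinearMap.add_apply, LinearMap.comp_apply, dKK_tmulA, dK_ract, map_add, hf.2]

lemma FK_isBilin : IsBilin (FK k V) := by
  constructor
  · intro a x y
    apply (toAlg k V).injective
    simp only [FK_tmulA, mu_lact, lact_ract, map_sub, toAlg_lact, toAlg_ract, map_mul]
    simp only [mul_assoc]
  · intro a x y
    apply (toAlg k V).injective
    simp only [FK_tmulA, mu_ract, lact_ract, map_sub, toAlg_lact, toAlg_ract, map_mul]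
    simp only [mul_assoc]

lemma lact_one (x : K k V) : lact k V 1 x = x :=
  (toAlg k V).injective (by simp [toAlg_lact])

lemma sgn_tmul (a b : A k V) (ω : ExteriorAlgebra k V) :
    sgn k V (a ⊗ₜ (ω ⊗ₜ b)) = a ⊗ₜ (sgnW k V ω ⊗ₜ b) := rfl

lemma homotopyForm_dGen_left (ω η : ExteriorAlgebra k V) (b : A k V) :
    homotopyForm k V (dK k V (1 ⊗ₜ (ω ⊗ₜ b)) ⊗ₜ (1 ⊗ₜ (η ⊗ₜ 1))) =
      leftFactor b (dAlg k V (inclW k V ω)) * scaleW Polynomial.X η := by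
  rw [dK_tmul, lact_one, homotopyForm_balanced, lact_tmul, homotopyForm_tmul, ← toAlg_dGen]
  simp [leftFactor]

/-- The sign `(-1)^|x|` of the tensor product differential is absorbed when `ω(1 - X)` moves in
front of `D`; what remains no longer involves `ω`. -/
lemma homotopyForm_sgnW_left (ω : ExteriorAlgebra k V) (b : A k V) (y : K k V) :
    homotopyForm k V ((1 ⊗ₜ (sgnW k V ω ⊗ₜ b)) ⊗ₜ y) =
      scaleW (1 - Polynomial.X) ω * rightFactor b (toAlg k V y) := by
  induction y using K_induction with
  | zero => simp
  | add x y hx hy => simp only [TensorProduct.tmul_add, map_add, hx, hy, mul_add]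
  | tmul c η e =>
    rw [toAlg_tmul, mul_assoc, rightFactor_mul, homotopyForm_tmul, homotopyLeft_tmul,
      ← mul_assoc (scaleW _ ω), ← derInterp_mul_scaleW_sgnW]
    simp [mul_assoc]

lemma homotopyForm_dGen_right (ω η : ExteriorAlgebra k V) (b : A k V) :
    homotopyForm k V (sgn k V (1 ⊗ₜ (ω ⊗ₜ b)) ⊗ₜ dK k V (1 ⊗ₜ (η ⊗ₜ 1))) =
      scaleW (1 - Polynomial.X) ω * rightFactor b (dAlg k V (inclW k V η)) := by
  rw [sgn_tmul, homotopyForm_sgnW_left, toAlg_dK, ← inclW_apply]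

/-- Integration of `dX_homotopyForm` over `[0, 1]`. The value at `X = 1` is `ε(ω) b ⊗ η ⊗ 1` and the
value at `X = 0` is `ε(η) 1 ⊗ ω ⊗ b`, where `ε` is the degree zero part; these are the two terms of
`F_K`. -/
lemma homotopy_isContractingHomotopy [CharZero k] : IsContractingHomotopy (homotopy k V) := by
  refine IsBilin.ext homotopy_isBilin.dK_add_dKK FK_isBilin fun ω η b => ?_
  apply (toAlg k V).injective
  rw [LinearMap.add_apply, LinearMap.comp_apply, LinearMap.comp_apply, dKK_tmulA, map_add, map_add,
    map_add, toAlg_dK, toAlg_homotopy, toAlg_homotopy, toAlg_homotopy, dAlg_integX,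
    homotopyForm_dGen_left, homotopyForm_dGen_right, ← add_assoc, ← map_add, ← map_add]
  have h : homotopyForm k V ((1 ⊗ₜ (ω ⊗ₜ b)) ⊗ₜ (1 ⊗ₜ (η ⊗ₜ 1))) =
      derInterp k V b * (scaleW (1 - Polynomial.X) ω * scaleW Polynomial.X η) := by
    rw [homotopyForm_tmul, homotopyLeft_tmul]
    simp [mul_assoc]
  rw [h, dX_homotopyForm, integX_derX, map_mul, map_mul, map_mul, map_mul, evalX_one_interp,
    evalX_zero_interp, evalX_scaleW_of_eval_eq_one (c := 1) (p := Polynomial.X) (by simp),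
    evalX_scaleW_of_eval_eq_zero (c := 0) (p := Polynomial.X) (by simp),
    evalX_scaleW_of_eval_eq_one (c := 0) (p := 1 - Polynomial.X) (by simp),
    evalX_scaleW_of_eval_eq_zero (c := 1) (p := 1 - Polynomial.X) (by simp), FK_tmulA, map_sub, toAlg_lact,
    toAlg_ract, mu_tmul, mu_tmul, toAlg_tmul, toAlg_tmul]
  simp [Algebra.algebraMap_eq_smul_one, inclR_comm]

end KoszulSym
end

/-! ### The coefficients of the homotopy. -/

noncomputable section
namespace KoszulSym

lemma exists_perm_map_eq {t : ℕ} (r i : Fin t) (S : Finset (Fin t)) (hi : i ∉ S)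
    (hS : S.card = r) :
    ∃ τ : Equiv.Perm (Fin t), τ r = i ∧ (Finset.Iio r).map τ.toEmbedding = S := by
  have hc : (Finset.Iio r).card = S.card := by simp [hS]
  let e : {x // x ∈ Finset.Iio r} ≃ {x // x ∈ S} := Finset.equivOfCardEq hc
  let τ := e.extendSubtype
  have h1 : ∀ x, x < r → τ x ∈ S := fun x hx => e.extendSubtype_mem x (Finset.mem_Iio.2 hx)
  have h2 : τ r ∉ S := e.extendSubtype_not_mem r (by simp)
  -- `τ` carries the first elements onto `S` but may send `r` to the wrong place. Both `τ r` and `i`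
  -- lie outside `S`, so the swap corrects this without moving `S`.
  refine ⟨Equiv.swap (τ r) i * τ, by simp, ?_⟩
  apply Finset.eq_of_subset_of_card_le
  · intro x hx
    obtain ⟨y, hy, rfl⟩ := Finset.mem_map.1 hx
    have hy' := h1 y (Finset.mem_Iio.1 hy)
    have : Equiv.swap (τ r) i (τ y) = τ y :=
      Equiv.swap_apply_of_ne_of_ne (fun h => h2 (h ▸ hy')) (fun h => hi (h ▸ hy'))
    simpa [this] using hy'
  · rw [Finset.card_map, hc]

lemma sum_powersetCard_erase_perm {t : ℕ} {M : Type*} [AddCommMonoid M] (r : ℕ)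
    (H : Fin t → Finset (Fin t) → M) (σ : Equiv.Perm (Fin t)) :
    ∑ i, ∑ S ∈ Finset.powersetCard r (Finset.univ.erase i), H (σ i) (S.map σ.toEmbedding) =
      ∑ i, ∑ S ∈ Finset.powersetCard r (Finset.univ.erase i), H i S := by
  rw [← Equiv.sum_comp σ (fun i => ∑ S ∈ Finset.powersetCard r (Finset.univ.erase i), H i S)]
  refine Finset.sum_congr rfl fun i _ => ?_
  have : (Finset.univ.erase (σ i)) = (Finset.univ.erase i).map σ.toEmbedding := by
    ext x
    obtain ⟨x, rfl⟩ := σ.surjective x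
    simp
  rw [this, Finset.powersetCard_map, Finset.sum_map]
  rfl

/-- A sum over all permutations of a function of `σ r` and of `σ {0, …, r - 1}`. -/
lemma sum_perm_eq {k M : Type*} [Field k] [CharZero k] [AddCommGroup M] [Module k M] {t : ℕ}
    (r : Fin t) (H : Fin t → Finset (Fin t) → M) :
    ∑ σ : Equiv.Perm (Fin t), H (σ r) ((Finset.Iio r).map σ.toEmbedding) =
      (((r : ℕ).factorial : k) * ((t - 1 - r).factorial : k)) •
        ∑ i, ∑ S ∈ Finset.powersetCard r (Finset.univ.erase i), H i S := by
  set N := ∑ σ : Equiv.Perm (Fin t), H (σ r) ((Finset.Iio r).map σ.toEmbedding) with hN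
  -- Double counting of the sum over all `σ` and all pairs `(i, S)`. For a fixed pair the sum over
  -- `σ` is `N`, since `(i, S)` is the image of `(r, {0, …, r - 1})` under some `τ`. For fixed `σ`
  -- the pairs are merely permuted, which gives `t!` equal sums.
  have h1 : ∀ i, ∀ S ∈ Finset.powersetCard (r : ℕ) (Finset.univ.erase i),
      ∑ σ : Equiv.Perm (Fin t), H (σ i) (S.map σ.toEmbedding) = N := by
    intro i S hS
    rw [Finset.mem_powersetCard] at hS
    obtain ⟨τ, rfl, rfl⟩ := exists_perm_map_eq r i S (fun h => by simpa using hS.1 h) hS.2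
    rw [hN, ← Equiv.sum_comp (Equiv.mulRight τ)
      fun σ => H (σ r) ((Finset.Iio r).map σ.toEmbedding)]
    refine Finset.sum_congr rfl fun σ _ => ?_
    rw [Finset.map_map]
    rfl
  have h2 : ∑ i : Fin t, ∑ S ∈ Finset.powersetCard (r : ℕ) (Finset.univ.erase i),
      ∑ σ : Equiv.Perm (Fin t), H (σ i) (S.map σ.toEmbedding) = (t * (t - 1).choose r) • N := by
    rw [Finset.sum_congr rfl fun i _ => Finset.sum_congr rfl (h1 i)]
    simp [Finset.card_powersetCard, Finset.card_erase_of_mem, mul_smul]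
  have h3 : ∑ i : Fin t, ∑ S ∈ Finset.powersetCard (r : ℕ) (Finset.univ.erase i),
      ∑ σ : Equiv.Perm (Fin t), H (σ i) (S.map σ.toEmbedding) =
      t.factorial • ∑ i, ∑ S ∈ Finset.powersetCard (r : ℕ) (Finset.univ.erase i), H i S := by
    have : ∀ i : Fin t, ∑ S ∈ Finset.powersetCard (r : ℕ) (Finset.univ.erase i),
      ∑ σ : Equiv.Perm (Fin t), H (σ i) (S.map σ.toEmbedding) = ∑ σ : Equiv.Perm (Fin t),
        ∑ S ∈ Finset.powersetCard (r : ℕ) (Finset.univ.erase i), H (σ i) (S.map σ.toEmbedding) :=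
      fun i => Finset.sum_comm
    rw [Finset.sum_congr rfl fun i _ => this i, Finset.sum_comm,
      Finset.sum_congr rfl fun σ _ => sum_powersetCard_erase_perm r H σ]
    simp [Fintype.card_perm]
  rw [h2] at h3
  have ht : 0 < t := r.pos
  have hr : (r : ℕ) ≤ t - 1 := by have := r.2; omega
  have h4 : t.factorial = t * (t - 1).choose r * ((r : ℕ).factorial * (t - 1 - r).factorial) := by
    rw [← Nat.mul_factorial_pred ht.ne', ← Nat.choose_mul_factorial_mul_factorial hr]; ring
  rw [h4, mul_smul (t * _)] at h3
  have h5 : ((t * (t - 1).choose r : ℕ) : k) ≠ 0 :=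
    Nat.cast_ne_zero.2 (Nat.mul_pos ht (Nat.choose_pos hr)).ne'
  rw [← Nat.cast_smul_eq_nsmul k, ← Nat.cast_smul_eq_nsmul k] at h3
  have h6 := smul_right_injective M h5 h3
  rw [h6, ← Nat.cast_smul_eq_nsmul k, Nat.cast_mul]

lemma factorial_mul_prod_range (n z : ℕ) :
    (n.factorial : ℚ) * ∏ i ∈ Finset.range z, (((n + 1 : ℕ) : ℚ) + i) = ((n + z).factorial : ℚ) := by
  induction z with
  | zero => simp
  | succ z ih =>
    rw [Finset.prod_range_succ, ← mul_assoc, ih, ← add_assoc, Nat.factorial_succ]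
    push_cast; ring

lemma factorial_mul_prod_Icc (m s : ℕ) :
    (m.factorial : ℚ) * ∏ j ∈ Finset.Icc 1 s, ((m : ℚ) + j) = ((m + s).factorial : ℚ) := by
  induction s with
  | zero => simp
  | succ s ih =>
    rw [Finset.prod_Icc_succ_top (by omega), ← mul_assoc, ih, ← add_assoc, Nat.factorial_succ]
    push_cast; ring

lemma coeff_eq_xi (s t z r : ℕ) (h1 : 1 ≤ r) (h2 : r ≤ t) :
    coeff s t z r = (-1) ^ (s * z + z) * xi s t z r := by
  obtain ⟨n, rfl⟩ : ∃ n, r = n + 1 := ⟨r - 1, by omega⟩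
  obtain ⟨m, rfl⟩ : ∃ m, t = n + 1 + m := ⟨t - (n + 1), by omega⟩
  have e1 : n + 1 + z - 1 = n + z := by omega
  have e2 : n + 1 + m - (n + 1) = m := by omega
  have e3 : ((n + 1 + m : ℕ) : ℚ) - ((n + 1 : ℕ) : ℚ) = m := by push_cast; ring
  rw [coeff, xi, e1, e2, e3, ← factorial_mul_prod_range n z, ← factorial_mul_prod_Icc m s,
    Nat.add_sub_cancel]
  have a1 : (n.factorial : ℚ) ≠ 0 := Nat.cast_ne_zero.2 n.factorial_ne_zero
  have a2 : (m.factorial : ℚ) ≠ 0 := Nat.cast_ne_zero.2 m.factorial_ne_zero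
  have a3 : ((s + (n + 1 + m) + z).factorial : ℚ) ≠ 0 := Nat.cast_ne_zero.2 (Nat.factorial_ne_zero _)
  field_simp

variable {k V : Type*} [Field k] [AddCommGroup V] [Module k V]

/-- The Beta integral. -/
lemma integ_X_pow_mul [CharZero k] (m n : ℕ) :
    integ k (Polynomial.X ^ m * (1 - Polynomial.X) ^ n) =
      (m.factorial * n.factorial : k) / ((m + n + 1).factorial : k) := by
  induction n generalizing m with
  | zero =>
    rw [pow_zero, mul_one, Polynomial.X_pow_eq_monomial]
    have : (m : k) + 1 ≠ 0 := Nat.cast_add_one_ne_zero m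
    have h : (m.factorial : k) ≠ 0 := Nat.cast_ne_zero.2 m.factorial_ne_zero
    simp only [integ, Polynomial.lsum_apply, Nat.factorial_succ, add_zero, Nat.factorial_zero]
    rw [Polynomial.sum_monomial_index _ _ (by simp)]
    push_cast
    simp
    field_simp
  | succ n ih =>
    -- Integration by parts: this polynomial vanishes at both `0` and `1`, so the integral of its
    -- derivative is zero, and this lowers `n` by one.
    have h := integ_derivative (k := k) (Polynomial.X ^ (m + 1) * (1 - Polynomial.X) ^ (n + 1))
    have hd : Polynomial.derivative
        (Polynomial.X ^ (m + 1) * (1 - Polynomial.X) ^ (n + 1) : Polynomial k) =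
        ((m : k) + 1) • (Polynomial.X ^ m * (1 - Polynomial.X) ^ (n + 1)) -
          ((n : k) + 1) • (Polynomial.X ^ (m + 1) * (1 - Polynomial.X) ^ n) := by
      simp only [Polynomial.derivative_mul, Polynomial.derivative_pow,
        map_sub, Polynomial.derivative_one, Polynomial.derivative_X, Polynomial.smul_eq_C_mul,
        Nat.add_sub_cancel]
      push_cast
      simp only [map_add, map_one, map_natCast]
      ring
    rw [hd, map_sub, map_smul, map_smul, ih] at h
    simp only [Polynomial.eval_mul, Polynomial.eval_pow, Polynomial.eval_sub, Polynomial.eval_one,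
      Polynomial.eval_X, sub_self, ne_eq, Nat.add_eq_zero_iff, one_ne_zero, and_false,
      not_false_eq_true, zero_pow, mul_zero, zero_mul, smul_eq_mul, sub_eq_zero] at h
    have hm : (m : k) + 1 ≠ 0 := Nat.cast_add_one_ne_zero m
    have e : m + (n + 1) + 1 = m + 1 + n + 1 := by omega
    rw [e]
    apply mul_left_cancel₀ hm
    rw [h, Nat.factorial_succ m, Nat.factorial_succ n]
    push_cast
    ring

lemma o_append {m n : ℕ} (a : Fin m → V) (b : Fin n → V) :
    (o (Fin.append a b) : ExteriorAlgebra k V) = o a * o b := by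
  rw [o, ExteriorAlgebra.ιMulti_mul_ιMulti]

lemma o_snoc {n : ℕ} (w : Fin n → V) (v : V) :
    (o (Fin.snoc w v : Fin (n + 1) → V) : ExteriorAlgebra k V) = o w * ExteriorAlgebra.ι k v := by
  have : (Fin.snoc w v : Fin (n + 1) → V) = Fin.append w (fun _ : Fin 1 => v) := by
    rw [Fin.append_right_eq_snoc]
  rw [this, o_append]
  simp [ExteriorAlgebra.ιMulti_apply]

lemma ι_mul_o {n : ℕ} (u : V) (w : Fin n → V) :
    ExteriorAlgebra.ι k u * o w = (-1 : k) ^ n • (o w * ExteriorAlgebra.ι k u) := by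
  induction n with
  | zero => simp
  | succ n ih =>
    rw [← Fin.cons_self_tail w, o_cons, ← mul_assoc,
      eq_neg_of_add_eq_zero_left (ExteriorAlgebra.ι_add_mul_swap u (w 0)), neg_mul, mul_assoc, ih,
      pow_succ]
    simp [mul_assoc]

lemma o_mul_o {m n : ℕ} (u : Fin m → V) (w : Fin n → V) :
    (o u * o w : ExteriorAlgebra k V) = (-1 : k) ^ (m * n) • (o w * o u) := by
  induction m with
  | zero => simp
  | succ m ih =>
    rw [← Fin.cons_self_tail u, o_cons, mul_assoc, ih, mul_smul_comm, ← mul_assoc, ι_mul_o,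
      smul_mul_assoc, smul_smul, mul_assoc, ← pow_add, add_mul, one_mul]

lemma cst_mul_scal_mul (a b : KAlg k V) (p q : Polynomial k) :
    cst k V a * scal k V p * (cst k V b * scal k V q) = cst k V (a * b) * scal k V (p * q) := by
  rw [mul_assoc, ← mul_assoc (scal k V p), scal_comm, map_mul, map_mul]; simp only [mul_assoc]

lemma scaleW_o (p : Polynomial k) {n : ℕ} (u : Fin n → V) :
    scaleW p (o u) = cst k V (inclW k V (o u)) * scal k V (p ^ n) := by
  induction n with
  | zero => simp
  | succ n ih =>
    rw [← Fin.cons_self_tail u, o_cons, map_mul, map_mul (inclW k V), ih, scaleW_ι, pow_succ',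
      cst_mul_scal_mul]

lemma derInterp_prod {ι : Type*} [DecidableEq ι] (s : Finset ι) (f : ι → A k V) :
    derInterp k V (∏ i ∈ s, f i) =
      ∑ i ∈ s, interp k V (∏ j ∈ s.erase i, f j) * derInterp k V (f i) := by
  induction s using Finset.induction_on with
  | empty => simp [derInterp_one]
  | insert a s ha ih =>
    rw [Finset.prod_insert ha, derInterp_mul, ih, Finset.sum_insert ha, Finset.erase_insert ha,
      add_comm, Finset.mul_sum]
    congr 1
    refine Finset.sum_congr rfl fun i hi => ?_
    have : i ≠ a := fun h => ha (h ▸ hi)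
    rw [Finset.erase_insert_of_ne this.symm, Finset.prod_insert (fun h => ha (Finset.mem_of_mem_erase h)),
      map_mul, mul_assoc]

/-- Each factor is a sum of a left and a right term; `S` records which factors go left. -/
lemma interp_prod {ι : Type*} [DecidableEq ι] (s : Finset ι) (v : ι → V) :
    interp k V (∏ i ∈ s, SymmetricAlgebra.ι k V (v i)) = ∑ S ∈ s.powerset,
      cst k V (inclL k V (∏ i ∈ S, SymmetricAlgebra.ι k V (v i)) *
        inclR k V (∏ i ∈ s \ S, SymmetricAlgebra.ι k V (v i))) *
      scal k V (Polynomial.X ^ S.card * (1 - Polynomial.X) ^ (s \ S).card) := by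
  induction s using Finset.induction_on with
  | empty => simp
  | insert a s ha ih =>
    rw [Finset.prod_insert ha, map_mul, ih, Finset.sum_powerset_insert ha, interp_ι, add_mul,
      Finset.mul_sum, Finset.mul_sum, add_comm]
    congr 1
    · refine Finset.sum_congr rfl fun S hS => ?_
      have haS : a ∉ S := fun h => ha (Finset.mem_powerset.1 hS h)
      have h1 : insert a s \ S = insert a (s \ S) := Finset.insert_sdiff_of_notMem s haS
      have h2 : a ∉ s \ S := fun h => ha (Finset.mem_sdiff.1 h).1
      rw [cst_mul_scal_mul, h1, Finset.prod_insert h2, Finset.card_insert_of_notMem h2, pow_succ,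
        map_mul (inclR k V), ← mul_assoc, inclR_comm, mul_assoc, mul_comm (1 - Polynomial.X)]
      simp only [mul_assoc]
    · refine Finset.sum_congr rfl fun S hS => ?_
      have haS : a ∉ S := fun h => ha (Finset.mem_powerset.1 hS h)
      have h1 : insert a s \ insert a S = s \ S := by
        ext x; simp only [Finset.mem_sdiff, Finset.mem_insert]
        constructor
        · rintro ⟨h | h, h'⟩ <;> tauto
        · rintro ⟨h, h'⟩
          refine ⟨Or.inr h, ?_⟩
          rintro (rfl | h'')
          · exact ha h
          · exact h' h''
      rw [cst_mul_scal_mul, h1, Finset.prod_insert haS, Finset.card_insert_of_notMem haS, pow_succ',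
        map_mul (inclL k V)]
      simp only [mul_assoc]

/-- `i` is the factor on which `D` acts and `S` the set of factors sent to the left. The powers of
`X` come from `S` and `w`, those of `1 - X` from the remaining factors and `u`, so the coefficient
is a Beta integral. -/
lemma toAlg_homotopy_monomial [CharZero k] {s t z : ℕ} (u : Fin s → V) (v : Fin t → V)
    (w : Fin z → V) :
    toAlg k V (homotopy k V (monomial u v w)) = ∑ i, ∑ S ∈ (Finset.univ.erase i).powerset,
      (((S.card + z).factorial * ((Finset.univ.erase i \ S).card + s).factorial : k) /
        ((s + t + z).factorial : k) * (-1) ^ (s * z + z)) •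
      toAlg k V ((∏ j ∈ S, SymmetricAlgebra.ι k V (v j)) ⊗ₜ[k]
        (o (Fin.append (Fin.snoc w (v i) : Fin (z + 1) → V) u) ⊗ₜ[k]
          ∏ j ∈ Finset.univ.erase i \ S, SymmetricAlgebra.ι k V (v j))) := by
  rw [monomial, toAlg_homotopy, homotopyForm_tmul, homotopyLeft_tmul, map_one, map_one, map_one,
    map_one, one_mul, mul_one, mul_one, mul_assoc, derInterp_prod, Finset.sum_mul, map_sum]
  refine Finset.sum_congr rfl fun i _ => ?_
  rw [interp_prod, Finset.sum_mul, Finset.sum_mul, map_sum]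
  refine Finset.sum_congr rfl fun S hS => ?_
  have hcard : S.card + (Finset.univ.erase i \ S).card + 1 = t := by
    rw [Finset.card_sdiff_of_subset (Finset.mem_powerset.1 hS)]
    have := Finset.card_le_card (Finset.mem_powerset.1 hS)
    have h2 : (Finset.univ.erase i).card = t - 1 := by simp [Finset.card_erase_of_mem]
    have := i.pos
    omega
  have h1 : derInterp k V (SymmetricAlgebra.ι k V (v i)) =
      cst k V (inclW k V (ExteriorAlgebra.ι k (v i))) * scal k V 1 := by
    rw [derInterp_ι, map_one, mul_one]
  rw [h1, scaleW_o, scaleW_o, cst_mul_scal_mul, cst_mul_scal_mul, cst_mul_scal_mul,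
    integX_cst_mul_scal]
  have h2 : (Polynomial.X ^ S.card * (1 - Polynomial.X) ^ (Finset.univ.erase i \ S).card * 1 *
      ((1 - Polynomial.X) ^ s * Polynomial.X ^ z) : Polynomial k) =
      Polynomial.X ^ (S.card + z) * (1 - Polynomial.X) ^ ((Finset.univ.erase i \ S).card + s) := by
    ring
  have h3 : S.card + z + ((Finset.univ.erase i \ S).card + s) + 1 = s + t + z := by omega
  rw [h2, integ_X_pow_mul, h3, mul_smul, toAlg_tmul, o_append, o_snoc]
  congr 1
  -- The integrand has the vectors in the order `v_i, u, w`. Moving the `z` vectors of `w` past the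
  -- other `s + 1` gives the sign `(-1)^(sz+z)`.
  have h4 : (ExteriorAlgebra.ι k (v i) * (o u * o w) : ExteriorAlgebra k V) =
      (-1 : k) ^ (s * z + z) • (o w * ExteriorAlgebra.ι k (v i) * o u) := by
    rw [← mul_assoc, ← o_cons, o_mul_o, o_cons, mul_assoc]
    congr 2; ring
  rw [mul_assoc, mul_assoc, ← map_mul (inclW k V), ← map_mul (inclW k V), h4, map_smul,
    mul_smul_comm, mul_smul_comm, inclR_comm]
  simp only [mul_assoc]

lemma sdiff_map_Iio {t : ℕ} (r : Fin t) (σ : Equiv.Perm (Fin t)) :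
    Finset.univ.erase (σ r) \ (Finset.Iio r).map σ.toEmbedding =
      (Finset.Ioi r).map σ.toEmbedding := by
  ext x
  obtain ⟨x, rfl⟩ := σ.surjective x
  simp [lt_iff_le_and_ne, eq_comm]
  grind

lemma homotopy_hasCoeffs [CharZero k] :
    HasCoeffs (fun s t z r => (coeff s t z r : k)) (homotopy k V) := by
  intro s t z u v w
  apply (toAlg k V).injective
  rw [toAlg_homotopy_monomial, map_sum]
  let H : Fin t → Finset (Fin t) → KAlg k V := fun i S =>
    toAlg k V ((∏ j ∈ S, SymmetricAlgebra.ι k V (v j)) ⊗ₜ[k]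
        (o (Fin.append (Fin.snoc w (v i) : Fin (z + 1) → V) u) ⊗ₜ[k]
          ∏ j ∈ Finset.univ.erase i \ S, SymmetricAlgebra.ι k V (v j)))
  have hr : ∀ r : Fin t, toAlg k V (∑ σ : Equiv.Perm (Fin t), (coeff s t z (r + 1) : k) •
      ((∏ i ∈ Finset.Iio r, SymmetricAlgebra.ι k V (v (σ i))) ⊗ₜ[k]
        (o (Fin.append (Fin.snoc w (v (σ r)) : Fin (z + 1) → V) u) ⊗ₜ[k]
          ∏ i ∈ Finset.Ioi r, SymmetricAlgebra.ι k V (v (σ i))))) =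
      ∑ i, ∑ S ∈ Finset.powersetCard r (Finset.univ.erase i),
        ((((r : ℕ) + z).factorial * ((t - 1 - r) + s).factorial : k) /
        ((s + t + z).factorial : k) * (-1) ^ (s * z + z)) • H i S := by
    intro r
    have h1 : ∀ σ : Equiv.Perm (Fin t), (coeff s t z (r + 1) : k) • toAlg k V
      ((∏ i ∈ Finset.Iio r, SymmetricAlgebra.ι k V (v (σ i))) ⊗ₜ[k]
        (o (Fin.append (Fin.snoc w (v (σ r)) : Fin (z + 1) → V) u) ⊗ₜ[k]
          ∏ i ∈ Finset.Ioi r, SymmetricAlgebra.ι k V (v (σ i)))) =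
        (coeff s t z (r + 1) : k) • H (σ r) ((Finset.Iio r).map σ.toEmbedding) := by
      intro σ
      simp only [H, sdiff_map_Iio, Finset.prod_map, Equiv.coe_toEmbedding]
    rw [map_sum]
    simp only [map_smul]
    rw [Finset.sum_congr rfl fun σ _ => h1 σ, ← Finset.smul_sum, sum_perm_eq (k := k), smul_smul]
    -- The factor `r! (t - 1 - r)!` counts the permutations with the same `i` and `S`, and cancels
    -- the denominator of `ξ`.
    have hc : (coeff s t z (r + 1) : k) *
        (((r : ℕ).factorial : k) * ((t - 1 - r).factorial : k)) =
        (((r : ℕ) + z).factorial * ((t - 1 - r) + s).factorial : k) /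
        ((s + t + z).factorial : k) * (-1) ^ (s * z + z) := by
      rw [coeff_eq_xi _ _ _ _ (by omega) (by have := r.2; omega), xi]
      have e1 : (r : ℕ) + 1 + z - 1 = r + z := by omega
      have e2 : t - ((r : ℕ) + 1) = t - 1 - r := by omega
      rw [e1, e2, Nat.add_sub_cancel]
      have a1 : ((r : ℕ).factorial : k) ≠ 0 := Nat.cast_ne_zero.2 (Nat.factorial_ne_zero _)
      have a2 : ((t - 1 - r).factorial : k) ≠ 0 := Nat.cast_ne_zero.2 (Nat.factorial_ne_zero _)
      have a3 : ((s + t + z).factorial : k) ≠ 0 := Nat.cast_ne_zero.2 (Nat.factorial_ne_zero _)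
      push_cast
      field_simp
    rw [hc, Finset.smul_sum]
    exact Finset.sum_congr rfl fun i _ => Finset.smul_sum
  rw [Finset.sum_congr rfl fun r _ => hr r, Finset.sum_comm]
  refine Finset.sum_congr rfl fun i _ => ?_
  have h2 : (Finset.univ.erase i).card + 1 = t := by
    have := i.pos
    simp [Finset.card_erase_of_mem]; omega
  -- The subsets of the other `t - 1` indices are grouped by cardinality, which runs through `0, …,
  -- t - 1` and so matches the zero-based `r`.
  rw [Finset.sum_powerset, h2, Finset.sum_range]
  refine Finset.sum_congr rfl fun r _ => Finset.sum_congr rfl fun S hS => ?_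
  rw [Finset.mem_powersetCard] at hS
  have h3 : (Finset.univ.erase i \ S).card = t - 1 - r := by
    rw [Finset.card_sdiff_of_subset hS.1, hS.2]; omega
  rw [hS.2, h3]

end KoszulSym
end

/-! ### Bimodule maps given on monomials: uniqueness and invariance. -/

noncomputable section
namespace KoszulSym
variable {k V : Type*} [Field k] [AddCommGroup V] [Module k V]

lemma mem_span_products (a : A k V) :
    a ∈ Submodule.span k {b : A k V | ∃ t, ∃ v : Fin t → V, b = ∏ i, SymmetricAlgebra.ι k V (v i)} := by
  set S := {b : A k V | ∃ t, ∃ v : Fin t → V, b = ∏ i, SymmetricAlgebra.ι k V (v i)} with hS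
  have hmul : ∀ x ∈ S, ∀ y ∈ S, x * y ∈ S := by
    rintro _ ⟨m, v, rfl⟩ _ ⟨n, w, rfl⟩
    exact ⟨m + n, Fin.append v w, by simp [Fin.prod_univ_add]⟩
  induction a using SymmetricAlgebra.induction with
  | algebraMap r =>
    rw [Algebra.algebraMap_eq_smul_one]
    exact Submodule.smul_mem _ _ (Submodule.subset_span ⟨0, Fin.elim0, by simp⟩)
  | ι v => exact Submodule.subset_span ⟨1, fun _ => v, by simp⟩
  | mul a b ha hb =>
    have h := Submodule.mul_mem_mul ha hb
    rw [Submodule.span_mul_span] at h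
    refine Submodule.span_mono ?_ h
    rintro _ ⟨x, hx, y, hy, rfl⟩
    exact hmul x hx y hy
  | add a b ha hb => exact Submodule.add_mem _ ha hb

lemma IsBilin.ext_monomial {f g : KK k V →ₗ[k] K k V} (hf : IsBilin f) (hg : IsBilin g)
    (h : ∀ (s t z : ℕ) (u : Fin s → V) (v : Fin t → V) (w : Fin z → V),
      f (monomial u v w) = g (monomial u v w)) : f = g := by
  refine hf.ext hg fun ω η b => ?_
  -- `T`, `T'` and `T''` are linear in `ω`, `η` and `b` respectively, with the other two arguments
  -- fixed. Each slot can thus be reduced to a spanning set in turn.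
  let T (p : KK k V →ₗ[k] K k V) (b : A k V) (η : ExteriorAlgebra k V) :
      ExteriorAlgebra k V →ₗ[k] K k V := p ∘ₗ (BalTensor.mk (ract k V) (lact k V)) ∘ₗ
        (TensorProduct.mk k (K k V) (K k V)).flip (1 ⊗ₜ (η ⊗ₜ 1)) ∘ₗ
          TensorProduct.mk k (A k V) _ 1 ∘ₗ (TensorProduct.mk k _ (A k V)).flip b
  let T' (p : KK k V →ₗ[k] K k V) (b : A k V) (ω : ExteriorAlgebra k V) :
      ExteriorAlgebra k V →ₗ[k] K k V := p ∘ₗ (BalTensor.mk (ract k V) (lact k V)) ∘ₗ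
        (TensorProduct.mk k (K k V) (K k V)) (1 ⊗ₜ (ω ⊗ₜ b)) ∘ₗ
          TensorProduct.mk k (A k V) _ 1 ∘ₗ (TensorProduct.mk k _ (A k V)).flip 1
  let T'' (p : KK k V →ₗ[k] K k V) (ω η : ExteriorAlgebra k V) :
      A k V →ₗ[k] K k V := p ∘ₗ (BalTensor.mk (ract k V) (lact k V)) ∘ₗ
        (TensorProduct.mk k (K k V) (K k V)).flip (1 ⊗ₜ (η ⊗ₜ 1)) ∘ₗ
          TensorProduct.mk k (A k V) _ 1 ∘ₗ (TensorProduct.mk k _ (A k V)) ω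
  have e1 : ∀ η b, (∀ s (u : Fin s → V), T f b η (o u) = T g b η (o u)) →
      ∀ ω, T f b η ω = T g b η ω := by
    intro η b hh ω
    induction ω using o_induction with
    | ho n v => exact hh n v
    | zero => simp
    | add x y hx hy => rw [map_add, map_add, hx, hy]
    | smul c x hx => rw [map_smul, map_smul, hx]
  have e2 : ∀ ω b, (∀ s (u : Fin s → V), T' f b ω (o u) = T' g b ω (o u)) →
      ∀ η, T' f b ω η = T' g b ω η := by
    intro ω b hh η
    induction η using o_induction with
    | ho n v => exact hh n v
    | zero => simp
    | add x y hx hy => rw [map_add, map_add, hx, hy]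
    | smul c x hx => rw [map_smul, map_smul, hx]
  refine e1 η b (fun s u => ?_) ω
  refine e2 (o u) b (fun z w => ?_) η
  change T'' f (o u) (o w) b = T'' g (o u) (o w) b
  have hb := mem_span_products b
  induction hb using Submodule.span_induction with
  | mem x hx => obtain ⟨t, v, rfl⟩ := hx; exact h s t z u v w
  | zero => simp
  | add x y _ _ hx hy => rw [map_add, map_add, hx, hy]
  | smul c x _ hx => rw [map_smul, map_smul, hx]

lemma HasCoeffs.unique {c : ℕ → ℕ → ℕ → ℕ → k} {f g : KK k V →ₗ[k] K k V} (hf : IsBilin f)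
    (hg : IsBilin g) (hf' : HasCoeffs c f) (hg' : HasCoeffs c g) : f = g :=
  hf.ext_monomial hg fun s t z u v w => by rw [hf', hg']

/-- The action of `g ∈ GL(V)` on `A`. -/
def actA (g : V ≃ₗ[k] V) : A k V →ₐ[k] A k V :=
  SymmetricAlgebra.lift (SymmetricAlgebra.ι k V ∘ₗ g.toLinearMap)

lemma actA_ι (g : V ≃ₗ[k] V) (v : V) :
    actA g (SymmetricAlgebra.ι k V v) = SymmetricAlgebra.ι k V (g v) := by
  simp [actA]

lemma actK_tmul (g : V ≃ₗ[k] V) (a b : A k V) (ω : ExteriorAlgebra k V) :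
    actK g (a ⊗ₜ (ω ⊗ₜ b)) =
      actA g a ⊗ₜ (ExteriorAlgebra.map g.toLinearMap ω ⊗ₜ actA g b) := rfl

lemma actA_symm_actA (g : V ≃ₗ[k] V) (a : A k V) : actA g.symm (actA g a) = a := by
  have : (actA g.symm).comp (actA g) = AlgHom.id k _ := by ext v; simp [actA_ι]
  exact DFunLike.congr_fun this a

lemma actK_symm_actK (g : V ≃ₗ[k] V) (x : K k V) : actK g.symm (actK g x) = x := by
  induction x using K_induction with
  | zero => simp
  | add x y hx hy => simp only [map_add, hx, hy]
  | tmul a ω b =>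
    have : (ExteriorAlgebra.map g.symm.toLinearMap).comp (ExteriorAlgebra.map g.toLinearMap) =
        AlgHom.id k _ := by ext v; simp
    rw [actK_tmul, actK_tmul, actA_symm_actA, actA_symm_actA]
    congr 2
    exact DFunLike.congr_fun this ω

lemma actK_lact (g : V ≃ₗ[k] V) (a : A k V) (x : K k V) :
    actK g (lact k V a x) = lact k V (actA g a) (actK g x) := by
  induction x using K_induction with
  | zero => simp
  | add x y hx hy => simp only [map_add, hx, hy]
  | tmul b ω c => rw [lact_tmul, actK_tmul, actK_tmul, lact_tmul, map_mul]

lemma actK_ract (g : V ≃ₗ[k] V) (a : A k V) (x : K k V) :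
    actK g (ract k V a x) = ract k V (actA g a) (actK g x) := by
  induction x using K_induction with
  | zero => simp
  | add x y hx hy => simp only [map_add, hx, hy]
  | tmul b ω c => rw [ract_tmul, actK_tmul, actK_tmul, ract_tmul, map_mul]

/-- The diagonal action of `g ∈ GL(V)` on `K ⊗_A K`. -/
def actKK (g : V ≃ₗ[k] V) : KK k V →ₗ[k] KK k V :=
  BalTensor.lift (ract k V) (lact k V)
    (BalTensor.mk (ract k V) (lact k V) ∘ₗ TensorProduct.map (actK g) (actK g)) <| by
    intro a x y
    simp only [LinearMap.comp_apply, TensorProduct.map_tmul, actK_lact, actK_ract,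
      BalTensor.mk_balanced]

lemma actKK_tmulA (g : V ≃ₗ[k] V) (x y : K k V) :
    actKK g (tmulA x y) = tmulA (actK g x) (actK g y) := by
  simp [actKK, tmulA]

lemma actKK_monomial (g : V ≃ₗ[k] V) {s t z : ℕ} (u : Fin s → V) (v : Fin t → V) (w : Fin z → V) :
    actKK g (monomial u v w) = monomial (g ∘ u) (g ∘ v) (g ∘ w) := by
  rw [monomial, actKK_tmulA, actK_tmul, actK_tmul, map_one, map_prod,
    ExteriorAlgebra.map_apply_ιMulti, ExteriorAlgebra.map_apply_ιMulti]
  simp only [actA_ι]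
  rfl

/-- A bimodule map given by coefficients is `GL(V)`-invariant. -/
lemma HasCoeffs.isGLInvariant {c : ℕ → ℕ → ℕ → ℕ → k} {f : KK k V →ₗ[k] K k V} (hf : IsBilin f)
    (hf' : HasCoeffs c f) : IsGLInvariant f := by
  intro g x y
  have hb : IsBilin (actK g.symm ∘ₗ f ∘ₗ actKK g) := by
    constructor
    · intro a x y
      simp only [LinearMap.comp_apply, actKK_tmulA, actK_lact, hf.1, actA_symm_actA]
    · intro a x y
      simp only [LinearMap.comp_apply, actKK_tmulA, actK_ract, hf.2, actA_symm_actA]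
  -- The conjugate of `f` by `g` is again a bimodule map, and the formula on monomials is natural in
  -- `V`, so both have the same values there.
  have h : actK g.symm ∘ₗ f ∘ₗ actKK g = f := by
    refine hb.ext_monomial hf fun s t z u v w => ?_
    have : ∀ x, f (actKK g (monomial u v w)) = actK g x → f (monomial u v w) = x →
        (actK g.symm ∘ₗ f ∘ₗ actKK g) (monomial u v w) = f (monomial u v w) := by
      intro x h1 h2
      rw [LinearMap.comp_apply, LinearMap.comp_apply, h1, h2, actK_symm_actK]
    refine this _ ?_ (hf' s t z u v w)
    rw [actKK_monomial, hf', map_sum]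
    refine Finset.sum_congr rfl fun r _ => ?_
    rw [map_sum]
    refine Finset.sum_congr rfl fun σ _ => ?_
    rw [map_smul, actK_tmul, map_prod, map_prod, ExteriorAlgebra.map_apply_ιMulti]
    simp only [actA_ι, Function.comp_apply]
    congr 4
    ext i
    refine Fin.addCases (fun i => ?_) (fun i => ?_) i
    · refine Fin.lastCases ?_ (fun i => ?_) i <;> simp
    · simp
  have h2 := LinearMap.congr_fun h (tmulA x y)
  rw [LinearMap.comp_apply, LinearMap.comp_apply, actKK_tmulA] at h2
  rw [← h2]
  have := actK_symm_actK g.symm (f (tmulA (actK g x) (actK g y)))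
  rw [LinearEquiv.symm_symm] at this
  exact this.symm

end KoszulSym
end

/-! ### Linear forms that isolate single terms. -/

noncomputable section
namespace KoszulSym
variable {k V : Type*} [Field k] [AddCommGroup V] [Module k V]

/-- The map `a ⊗ ω ⊗ b ↦ ℓ₁(a) ℓ₂(b) ω`. -/
def slice (l₁ l₂ : A k V →ₗ[k] k) : K k V →ₗ[k] ExteriorAlgebra k V :=
  (TensorProduct.lid k (ExteriorAlgebra k V)).toLinearMap ∘ₗ
    TensorProduct.map l₁ ((TensorProduct.rid k (ExteriorAlgebra k V)).toLinearMap ∘ₗ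
      LinearMap.lTensor _ l₂)

lemma slice_tmul (l₁ l₂ : A k V →ₗ[k] k) (a b : A k V) (ω : ExteriorAlgebra k V) :
    slice l₁ l₂ (a ⊗ₜ (ω ⊗ₜ b)) = (l₁ a * l₂ b) • ω := by
  simp [slice, smul_smul, mul_comm]

lemma slice_lact (l₁ l₂ : A k V →ₗ[k] k) (a : A k V) (x : K k V) :
    slice l₁ l₂ (lact k V a x) = slice (l₁ ∘ₗ LinearMap.mulLeft k a) l₂ x := by
  induction x using K_induction with
  | zero => simp
  | add x y hx hy => simp only [map_add, hx, hy]
  | tmul b ω c => simp [slice_tmul]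

lemma slice_ract (l₁ l₂ : A k V →ₗ[k] k) (a : A k V) (x : K k V) :
    slice l₁ l₂ (ract k V a x) = slice l₁ (l₂ ∘ₗ LinearMap.mulRight k a) x := by
  induction x using K_induction with
  | zero => simp
  | add x y hx hy => simp only [map_add, hx, hy]
  | tmul b ω c => simp [slice_tmul]

/-- The contraction of the exterior algebra with a linear form. -/
def contr (f : Module.Dual k V) : ExteriorAlgebra k V →ₗ[k] ExteriorAlgebra k V :=
  CliffordAlgebra.contractLeft (Q := (0 : QuadraticForm k V)) f

lemma contr_ι_mul (f : Module.Dual k V) (u : V) (ω : ExteriorAlgebra k V) :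
    contr f (ExteriorAlgebra.ι k u * ω) = f u • ω - ExteriorAlgebra.ι k u * contr f ω :=
  CliffordAlgebra.contractLeft_ι_mul _ _ _

lemma contr_one (f : Module.Dual k V) : contr f (1 : ExteriorAlgebra k V) = 0 :=
  CliffordAlgebra.contractLeft_one (Q := (0 : QuadraticForm k V)) f

lemma contr_o_mul (f : Module.Dual k V) {n : ℕ} (w : Fin n → V) (hw : ∀ i, f (w i) = 0)
    (ω : ExteriorAlgebra k V) : contr f (o w * ω) = (-1 : k) ^ n • (o w * contr f ω) := by
  induction n with
  | zero => simp
  | succ n ih =>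
    rw [← Fin.cons_self_tail w, o_cons, mul_assoc, contr_ι_mul, hw, ih (Fin.tail w) fun i => hw i.succ]
    simp [pow_succ, mul_assoc]

lemma contr_o (f : Module.Dual k V) {n : ℕ} (w : Fin n → V) (hw : ∀ i, f (w i) = 0) :
    contr f (o w) = 0 := by
  simpa [contr_one] using contr_o_mul f w hw 1

/-- After slicing, `v ⊗ 1 - 1 ⊗ v` becomes the scalar `f v`, so the Koszul differential turns into
the superderivation of `Λ V` that extends `f`, which is the contraction. -/
lemma slice_dGen (l₁ l₂ : A k V →ₗ[k] k) (f : Module.Dual k V)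
    (hf : ∀ x, f x = l₁ (SymmetricAlgebra.ι k V x) * l₂ 1 - l₁ 1 * l₂ (SymmetricAlgebra.ι k V x))
    (ω : ExteriorAlgebra k V) : slice l₁ l₂ (dGen k V ω) = contr f ω := by
  have key : ∀ ω, slice l₁ l₂ ((toAlg k V).symm (dAlg k V (inclW k V ω))) = contr f ω := by
    intro ω
    induction ω using ext_induction with
    | one => simp [dAlg_one, contr_one]
    | add x y hx hy => simp only [map_add, hx, hy]
    | smul c x hx => simp only [map_smul, hx]
    | ι_mul u ω ih =>
      have h1 : ∀ x : K k V, slice l₁ l₂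
          ((toAlg k V).symm (inclW k V (ExteriorAlgebra.ι k u) * toAlg k V x)) =
          ExteriorAlgebra.ι k u * slice l₁ l₂ x := by
        intro x
        induction x using K_induction with
        | zero => simp
        | add x y hx hy => simp only [map_add, mul_add, hx, hy]
        | tmul b ω c => simp [inclW_apply, tmul_mul_tmul, slice_tmul]
      have h2 : slice l₁ l₂ ((toAlg k V).symm (diffLR k V u * inclW k V ω)) = f u • ω := by
        rw [diffLR_apply, sub_mul, map_sub, map_sub, inclL_apply, inclR_apply, inclW_apply,
          tmul_mul_tmul, tmul_mul_tmul]
        simp [slice_tmul, hf, sub_smul]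
      rw [dAlg_inclW_ι_mul, map_sub, map_sub, h2, contr_ι_mul, ← ih,
        ← (toAlg k V).apply_symm_apply (dAlg k V (inclW k V ω)), h1]
      simp
  rw [← key, ← toAlg_dGen]; simp

lemma slice_dK_tmul (l₁ l₂ : A k V →ₗ[k] k) (f : Module.Dual k V) (a b : A k V)
    (hf : ∀ x, f x = l₁ (SymmetricAlgebra.ι k V x * a) * l₂ b -
      l₁ a * l₂ (SymmetricAlgebra.ι k V x * b))
    (ω : ExteriorAlgebra k V) : slice l₁ l₂ (dK k V (a ⊗ₜ (ω ⊗ₜ b))) = contr f ω := by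
  rw [dK_tmul, slice_lact, slice_ract]
  exact slice_dGen _ _ _ (fun x => by simp [hf, mul_comm]) _

/-- Contracting with `f 0` strips off the first vector, since `f 0` kills the others; repetition
ends at `1`. -/
lemma o_ne_zero {n : ℕ} (x : Fin n → V) (f : Fin n → Module.Dual k V)
    (h : ∀ i j, f i (x j) = if i = j then 1 else 0) : (o x : ExteriorAlgebra k V) ≠ 0 := by
  induction n with
  | zero => simp
  | succ n ih =>
    intro h0
    apply ih (Fin.tail x) (Fin.tail f) fun i j => by simp [Fin.tail, h]
    have h1 : contr (f 0) (o x) = o (Fin.tail x) := by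
      rw [← Fin.cons_self_tail x, o_cons, contr_ι_mul, contr_o _ _ fun i => by
        simp [Fin.tail, h, (Fin.succ_ne_zero i).symm]]
      simp [h]
    rw [← h1, h0, map_zero]

/-- Enough linearly independent vectors, with linear forms to separate them. -/
lemma exists_family [FiniteDimensional k V] (s z : ℕ) (h : z + 1 + s + 1 ≤ Module.finrank k V) :
    ∃ (w : Fin z → V) (v : V) (u : Fin s → V) (y : V) (f g : Module.Dual k V),
      f y = 1 ∧ f v = 0 ∧ (∀ i, f (w i) = 0) ∧ (∀ i, f (u i) = 0) ∧ g v = 1 ∧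
        o w * ExteriorAlgebra.ι k v * o u ≠ 0 := by
  let B := Module.finBasis k V
  let x : Fin (z + 1 + s) → V := fun i => B (Fin.castLE (by omega) i)
  -- The basis vector just after those used for `w`, `v`, `u` serves as `y`, and its coordinate as
  -- `f`.
  let N : Fin (Module.finrank k V) := ⟨z + 1 + s, by omega⟩
  have hN : ∀ i : Fin (z + 1 + s), B.coord N (x i) = 0 := by
    intro i
    have : Fin.castLE (by omega) i ≠ N := fun h => by
      have := congrArg Fin.val h
      have hi := i.2
      simp [N] at this
      omega
    simp [x, this]
  refine ⟨fun i => x (Fin.castAdd s i.castSucc), x (Fin.castAdd s (Fin.last z)),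
    fun i => x (Fin.natAdd (z + 1) i), B N, B.coord N,
    B.coord (Fin.castLE (by omega) (Fin.castAdd s (Fin.last z))), by simp, hN _, fun i => hN _,
    fun i => hN _, by simp [x], ?_⟩
  rw [← o_snoc, ← o_append]
  have h1 : (Fin.append (Fin.snoc (fun i => x (Fin.castAdd s i.castSucc))
      (x (Fin.castAdd s (Fin.last z))) : Fin (z + 1) → V) (fun i => x (Fin.natAdd (z + 1) i))) =
      x := by
    ext i
    refine Fin.addCases (fun i => ?_) (fun i => ?_) i
    · refine Fin.lastCases ?_ (fun i => ?_) i <;> simp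
    · simp
  rw [h1]
  refine o_ne_zero x (fun i => B.coord (Fin.castLE (by omega) i)) fun i j => ?_
  simp only [x, Module.Basis.coord_apply, Module.Basis.repr_self, Finsupp.single_apply]
  simp [Fin.ext_iff, eq_comm]

/-- A linear form on `A` that picks the coefficient of `y v ^ n`, where `f y = 1`. -/
lemma exists_form (f g : Module.Dual k V) (v : V) (n : ℕ) (hf : f v = 0) (hg : g v = 1) :
    ∃ l : A k V →ₗ[k] k, (∀ i, l (SymmetricAlgebra.ι k V v ^ i) = 0) ∧
      ∀ a i, l (SymmetricAlgebra.ι k V a * SymmetricAlgebra.ι k V v ^ i) =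
        if i = n then f a else 0 := by
  -- `g` is recorded by the inner variable and `f` by the outer one. Since `v` maps to the inner
  -- variable alone, the coefficient of outer degree `1` and inner degree `n` detects `y v^n`.
  let F : V →ₗ[k] Polynomial (Polynomial k) :=
    g.smulRight (Polynomial.C Polynomial.X) + f.smulRight Polynomial.X
  let l : A k V →ₗ[k] k := Polynomial.lcoeff k n ∘ₗ
    (Polynomial.lcoeff (Polynomial k) 1).restrictScalars k ∘ₗ (SymmetricAlgebra.lift F).toLinearMap
  have hv : F v = Polynomial.C Polynomial.X := by simp [F, hf, hg]
  have hp : ∀ i, SymmetricAlgebra.lift F (SymmetricAlgebra.ι k V v ^ i) =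
      Polynomial.C (Polynomial.X ^ i) := fun i => by
    rw [map_pow, SymmetricAlgebra.lift_ι_apply, hv, Polynomial.C_pow]
  refine ⟨l, fun i => ?_, fun a i => ?_⟩
  · simp only [l, LinearMap.comp_apply, AlgHom.toLinearMap_apply, hp,
      LinearMap.restrictScalars_apply, Polynomial.lcoeff_apply]
    rw [Polynomial.coeff_C_of_ne_zero one_ne_zero, Polynomial.coeff_zero]
  · have : (F a * Polynomial.C (Polynomial.X ^ i)).coeff 1 = Polynomial.C (f a) * Polynomial.X ^ i := by
      rw [Polynomial.coeff_mul_C]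
      simp [F, Polynomial.smul_eq_C_mul]
    simp only [l, LinearMap.comp_apply, LinearMap.restrictScalars_apply, AlgHom.toLinearMap_apply,
      map_mul, hp, SymmetricAlgebra.lift_ι_apply, Polynomial.lcoeff_apply]
    rw [this, Polynomial.coeff_C_mul, Polynomial.coeff_X_pow]
    simp [eq_comm]

/-- A linear form on `A` that is `1` on the powers of `v`. -/
lemma exists_form_one (g : Module.Dual k V) (v : V) (hg : g v = 1) :
    ∃ l : A k V →ₗ[k] k, ∀ i, l (SymmetricAlgebra.ι k V v ^ i) = 1 :=
  ⟨(SymmetricAlgebra.lift g).toLinearMap, fun i => by simp [hg]⟩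

section Slices

variable {c : ℕ → ℕ → ℕ → ℕ → k} {ψ : KK k V →ₗ[k] K k V}

lemma HasCoeffs.monomial_const (hψ : HasCoeffs c ψ) {s z : ℕ} (t : ℕ) (u : Fin s → V) (v : V)
    (w : Fin z → V) : ψ (monomial u (fun _ : Fin t => v) w) = ∑ r : Fin t,
      ((t.factorial : k) * c s t z (r + 1)) • ((SymmetricAlgebra.ι k V v ^ (r : ℕ)) ⊗ₜ[k]
        ((o w * ExteriorAlgebra.ι k v * o u) ⊗ₜ[k] (SymmetricAlgebra.ι k V v ^ (t - 1 - r)))) := by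
  rw [hψ]
  refine Finset.sum_congr rfl fun r _ => ?_
  simp only [Finset.prod_const, Fin.card_Iio, Fin.card_Ioi, Finset.sum_const, Finset.card_univ,
    Fintype.card_perm, Fintype.card_fin, o_append, o_snoc]
  rw [← Nat.cast_smul_eq_nsmul k, smul_smul]

/-- Each position of the element `0` is attained by `t!` permutations of `t + 1` elements. -/
lemma sum_perm_symm_zero {M : Type*} [AddCommMonoid M] (t : ℕ) (T : Fin (t + 1) → M) :
    ∑ σ : Equiv.Perm (Fin (t + 1)), T (σ.symm 0) = t.factorial • ∑ p, T p := by
  rw [← Equiv.sum_comp (Equiv.inv (Equiv.Perm (Fin (t + 1)))) fun σ => T (σ.symm 0),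
    ← Equiv.sum_comp Equiv.Perm.decomposeFin.symm, Fintype.sum_prod_type, Finset.smul_sum]
  refine Finset.sum_congr rfl fun p _ => ?_
  have : ∀ e : Equiv.Perm (Fin t),
      T ((Equiv.inv (Equiv.Perm (Fin (t + 1))) (Equiv.Perm.decomposeFin.symm (p, e))).symm 0) =
        T p := by
    intro e
    congr 1
    exact Equiv.Perm.decomposeFin_symm_apply_zero p e
  rw [Finset.sum_congr rfl fun e _ => this e]
  simp [Fintype.card_perm]

/-- With only one factor different from `v`, a permutation matters only through the position `p` of
`a`. -/
lemma HasCoeffs.monomial_cons (hψ : HasCoeffs c ψ) {s z : ℕ} (t : ℕ) (u : Fin s → V) (a v : V)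
    (w : Fin z → V) : ψ (monomial u (Fin.cons a (fun _ => v) : Fin (t + 1) → V) w) =
      ∑ r : Fin (t + 1), ∑ p : Fin (t + 1), ((t.factorial : k) * c s (t + 1) z (r + 1)) •
        ((∏ i ∈ Finset.Iio r, SymmetricAlgebra.ι k V (if i = p then a else v)) ⊗ₜ[k]
        ((o w * ExteriorAlgebra.ι k (if r = p then a else v) * o u) ⊗ₜ[k]
          ∏ i ∈ Finset.Ioi r, SymmetricAlgebra.ι k V (if i = p then a else v))) := by
  rw [hψ]
  refine Finset.sum_congr rfl fun r _ => ?_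
  have h : ∀ (σ : Equiv.Perm (Fin (t + 1))) (i : Fin (t + 1)),
      (Fin.cons a (fun _ => v) : Fin (t + 1) → V) (σ i) = if i = σ.symm 0 then a else v := by
    intro σ i
    simp only [Equiv.eq_symm_apply]
    by_cases hi : σ i = 0
    · simp [hi]
    · obtain ⟨j, hj⟩ := Fin.exists_succ_eq.2 hi
      rw [if_neg hi, ← hj, Fin.cons_succ]
  simp only [h, o_append, o_snoc]
  rw [sum_perm_symm_zero t (fun p => c s (t + 1) z (r + 1) •
        ((∏ i ∈ Finset.Iio r, SymmetricAlgebra.ι k V (if i = p then a else v)) ⊗ₜ[k]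
        ((o w * ExteriorAlgebra.ι k (if r = p then a else v) * o u) ⊗ₜ[k]
          ∏ i ∈ Finset.Ioi r, SymmetricAlgebra.ι k V (if i = p then a else v)))),
    ← Nat.cast_smul_eq_nsmul k, Finset.smul_sum]
  simp only [smul_smul]

lemma prod_ite_eq_pow {ι : Type*} [DecidableEq ι] (S : Finset ι) (p : ι) (a v : V) :
    ∏ i ∈ S, SymmetricAlgebra.ι k V (if i = p then a else v) =
      if p ∈ S then SymmetricAlgebra.ι k V a * SymmetricAlgebra.ι k V v ^ (S.card - 1)
      else SymmetricAlgebra.ι k V v ^ S.card := by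
  split_ifs with h
  · rw [← Finset.mul_prod_erase S _ h, if_pos rfl, ← Finset.card_erase_of_mem h, ← Finset.prod_const]
    congr 1
    exact Finset.prod_congr rfl fun i hi => by rw [if_neg (Finset.ne_of_mem_erase hi)]
  · rw [← Finset.prod_const]
    exact Finset.prod_congr rfl fun i hi => by rw [if_neg (ne_of_mem_of_not_mem hi h)]

variable {l₁ l₂ : A k V →ₗ[k] k} {f : Module.Dual k V} {v : V} {n : ℕ}

/-- `l₁` kills pure powers of `v`, so `a` must lie to the left, together with exactly `n` copies of
`v`. This forces the zero-based `r` to be `n + 1`, hence the coefficient index `n + 2`, and leaves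
`n + 1` positions for `a`. -/
lemma slice_monomial_cons_left (hψ : HasCoeffs c ψ)
    (h₁ : ∀ i, l₁ (SymmetricAlgebra.ι k V v ^ i) = 0)
    (h₁' : ∀ a i, l₁ (SymmetricAlgebra.ι k V a * SymmetricAlgebra.ι k V v ^ i) =
        if i = n then f a else 0)
    (h₂ : ∀ i, l₂ (SymmetricAlgebra.ι k V v ^ i) = 1) {s z t : ℕ} (hn : n < t) (u : Fin s → V)
    (a : V) (w : Fin z → V) :
    slice l₁ l₂ (ψ (monomial u (Fin.cons a (fun _ => v) : Fin (t + 1) → V) w)) =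
      ((t.factorial : k) * c s (t + 1) z (n + 2) * (n + 1) * f a) •
        (o w * ExteriorAlgebra.ι k v * o u) := by
  rw [hψ.monomial_cons, map_sum]
  have h : ∀ r p : Fin (t + 1), slice l₁ l₂ (((t.factorial : k) * c s (t + 1) z (r + 1)) •
        ((∏ i ∈ Finset.Iio r, SymmetricAlgebra.ι k V (if i = p then a else v)) ⊗ₜ[k]
        ((o w * ExteriorAlgebra.ι k (if r = p then a else v) * o u) ⊗ₜ[k]
          ∏ i ∈ Finset.Ioi r, SymmetricAlgebra.ι k V (if i = p then a else v)))) =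
      if p ∈ Finset.Iio r then (if (r : ℕ) = n + 1 then
        ((t.factorial : k) * c s (t + 1) z (r + 1) * f a) •
          (o w * ExteriorAlgebra.ι k v * o u) else 0) else 0 := by
    intro r p
    rw [map_smul, slice_tmul, prod_ite_eq_pow, prod_ite_eq_pow]
    by_cases hp : p ∈ Finset.Iio r
    · have hp' := Finset.mem_Iio.1 hp
      have h1 : p ∉ Finset.Ioi r := by simp [hp'.le]
      have h2 : r ≠ p := hp'.ne'
      rw [if_pos hp, if_neg h1, if_neg h2, if_pos hp, h₁', h₂, Fin.card_Iio]
      have h3 : ((r : ℕ) - 1 = n) ↔ ((r : ℕ) = n + 1) := by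
        have : (p : ℕ) < r := hp'
        omega
      simp only [h3]
      split_ifs with h4
      · rw [mul_one, smul_smul]
      · simp
    · rw [if_neg hp, if_neg hp, h₁, zero_mul, zero_smul, smul_zero]
  simp only [map_sum, h]
  simp only [Finset.sum_ite_mem, Finset.univ_inter, Finset.sum_const, Fin.card_Iio]
  rw [Finset.sum_eq_single (⟨n + 1, by omega⟩ : Fin (t + 1))]
  · simp only [if_true]
    rw [← Nat.cast_smul_eq_nsmul k, smul_smul]
    congr 1
    push_cast; ring
  · intro r _ hr
    rw [if_neg (fun h => hr (Fin.ext h)), smul_zero]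
  · simp

/-- Now `a` and `n` copies of `v` lie to the right. Of the `t + 1` factors this leaves `t - 1 - n`
on the left, so the one-based index is `t - n`. -/
lemma slice_monomial_cons_right (hψ : HasCoeffs c ψ)
    (h₁ : ∀ i, l₁ (SymmetricAlgebra.ι k V v ^ i) = 1)
    (h₂ : ∀ i, l₂ (SymmetricAlgebra.ι k V v ^ i) = 0)
    (h₂' : ∀ a i, l₂ (SymmetricAlgebra.ι k V a * SymmetricAlgebra.ι k V v ^ i) =
        if i = n then f a else 0)
    {s z t : ℕ} (hn : n < t) (u : Fin s → V)
    (a : V) (w : Fin z → V) :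
    slice l₁ l₂ (ψ (monomial u (Fin.cons a (fun _ => v) : Fin (t + 1) → V) w)) =
      ((t.factorial : k) * c s (t + 1) z (t - n) * (n + 1) * f a) •
        (o w * ExteriorAlgebra.ι k v * o u) := by
  rw [hψ.monomial_cons, map_sum]
  have h : ∀ r p : Fin (t + 1), slice l₁ l₂ (((t.factorial : k) * c s (t + 1) z (r + 1)) •
        ((∏ i ∈ Finset.Iio r, SymmetricAlgebra.ι k V (if i = p then a else v)) ⊗ₜ[k]
        ((o w * ExteriorAlgebra.ι k (if r = p then a else v) * o u) ⊗ₜ[k]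
          ∏ i ∈ Finset.Ioi r, SymmetricAlgebra.ι k V (if i = p then a else v)))) =
      if p ∈ Finset.Ioi r then (if (r : ℕ) = t - 1 - n then
        ((t.factorial : k) * c s (t + 1) z (r + 1) * f a) •
          (o w * ExteriorAlgebra.ι k v * o u) else 0) else 0 := by
    intro r p
    rw [map_smul, slice_tmul, prod_ite_eq_pow, prod_ite_eq_pow]
    by_cases hp : p ∈ Finset.Ioi r
    · have hp' := Finset.mem_Ioi.1 hp
      have h1 : p ∉ Finset.Iio r := by simp [hp'.le]
      have h2 : r ≠ p := hp'.ne
      rw [if_pos hp, if_neg h1, if_neg h2, if_pos hp, h₁, h₂', Fin.card_Ioi]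
      have h3 : (t + 1 - 1 - (r : ℕ) - 1 = n) ↔ ((r : ℕ) = t - 1 - n) := by
        have : (r : ℕ) < p := hp'
        have := p.2
        omega
      simp only [h3]
      split_ifs with h4
      · rw [one_mul, smul_smul]
      · simp
    · rw [if_neg hp, if_neg hp, h₂, mul_zero, zero_smul, smul_zero]
  simp only [map_sum, h]
  simp only [Finset.sum_ite_mem, Finset.univ_inter, Finset.sum_const, Fin.card_Ioi]
  rw [Finset.sum_eq_single (⟨t - 1 - n, by omega⟩ : Fin (t + 1))]
  · simp only [if_true]
    have e1 : t + 1 - 1 - (t - 1 - n) = n + 1 := by omega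
    have e2 : t - 1 - n + 1 = t - n := by omega
    rw [← Nat.cast_smul_eq_nsmul k, smul_smul, e1, e2]
    congr 1
    push_cast; ring
  · intro r _ hr
    rw [if_neg (fun h => hr (Fin.ext h)), smul_zero]
  · simp

end Slices

end KoszulSym
end

/-! ### The recursions for the coefficients. -/

noncomputable section
namespace KoszulSym
variable {k V : Type*} [Field k] [AddCommGroup V] [Module k V]

lemma contr_zero (ω : ExteriorAlgebra k V) : contr 0 ω = 0 := by simp [contr]

lemma contr_neg (f : Module.Dual k V) (ω : ExteriorAlgebra k V) : contr (-f) ω = -contr f ω := by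
  simp [contr]

lemma monomial_const {s z : ℕ} (t : ℕ) (u : Fin s → V) (v : V) (w : Fin z → V) :
    monomial u (fun _ : Fin t => v) w =
      tmulA ((1 : A k V) ⊗ₜ[k] (o u ⊗ₜ[k] (SymmetricAlgebra.ι k V v ^ t)))
        ((1 : A k V) ⊗ₜ[k] (o w ⊗ₜ[k] (1 : A k V))) := by
  simp [monomial]

lemma monomial_cons_const {s z : ℕ} (t : ℕ) (u : Fin s → V) (a v : V) (w : Fin z → V) :
    monomial u (Fin.cons a (fun _ => v) : Fin (t + 1) → V) w =
      tmulA ((1 : A k V) ⊗ₜ[k] (o u ⊗ₜ[k]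
          (SymmetricAlgebra.ι k V a * SymmetricAlgebra.ι k V v ^ t)))
        ((1 : A k V) ⊗ₜ[k] (o w ⊗ₜ[k] (1 : A k V))) := by
  simp [monomial, Fin.prod_univ_succ]

lemma tmulA_sum_left {ι : Type*} (S : Finset ι) (x : ι → K k V) (y : K k V) :
    tmulA (∑ i ∈ S, x i) y = ∑ i ∈ S, tmulA (x i) y := by
  simp [tmulA, TensorProduct.sum_tmul]

lemma tmulA_sum_right {ι : Type*} (S : Finset ι) (x : K k V) (y : ι → K k V) :
    tmulA x (∑ i ∈ S, y i) = ∑ i ∈ S, tmulA x (y i) := by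
  simp [tmulA, TensorProduct.tmul_sum]

lemma tmulA_smul_left (a : k) (x y : K k V) : tmulA (a • x) y = a • tmulA x y := by
  rw [tmulA, ← TensorProduct.smul_tmul', map_smul, tmulA]

lemma tmulA_smul_right (a : k) (x y : K k V) : tmulA x (a • y) = a • tmulA x y := by
  simp [tmulA, TensorProduct.tmul_smul]

lemma tmulA_sub_left (x x' y : K k V) : tmulA (x - x') y = tmulA x y - tmulA x' y := by
  simp [tmulA, TensorProduct.sub_tmul]

lemma tmulA_sub_right (x y y' : K k V) : tmulA x (y - y') = tmulA x y - tmulA x y' := by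
  simp [tmulA, TensorProduct.tmul_sub]

lemma IsBilin.apply_dK_tmulA {ψ : KK k V →ₗ[k] K k V} (hψ : IsBilin ψ) {s z : ℕ} (t : ℕ)
    (u : Fin (s + 1) → V) (v : V) (w : Fin z → V) :
    ψ (tmulA (dK k V ((1 : A k V) ⊗ₜ[k] (o u ⊗ₜ[k] (SymmetricAlgebra.ι k V v ^ t))))
        ((1 : A k V) ⊗ₜ[k] (o w ⊗ₜ[k] (1 : A k V)))) =
      ∑ j : Fin (s + 1), (-1 : k) ^ (j : ℕ) •
        (lact k V (SymmetricAlgebra.ι k V (u j))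
          (ψ (monomial (j.removeNth u) (fun _ : Fin t => v) w)) -
        ψ (monomial (j.removeNth u) (Fin.cons (u j) (fun _ => v) : Fin (t + 1) → V) w)) := by
  have h : (1 : A k V) ⊗ₜ[k] (o u ⊗ₜ[k] (SymmetricAlgebra.ι k V v ^ t)) =
      ract k V (SymmetricAlgebra.ι k V v ^ t) (1 ⊗ₜ (o u ⊗ₜ 1)) := by simp
  rw [h, dK_ract, dK_o, map_sum, tmulA_sum_left, map_sum]
  refine Finset.sum_congr rfl fun j _ => ?_
  rw [map_smul, tmulA_smul_left, map_smul, map_sub, tmulA_sub_left, map_sub, monomial_const,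
    monomial_cons_const, ← hψ.1]
  simp

lemma IsBilin.apply_tmulA_dK {ψ : KK k V →ₗ[k] K k V} (hψ : IsBilin ψ) {s z : ℕ} (t : ℕ)
    (u : Fin s → V) (v : V) (w : Fin (z + 1) → V) :
    ψ (tmulA ((1 : A k V) ⊗ₜ[k] (o u ⊗ₜ[k] (SymmetricAlgebra.ι k V v ^ t)))
        (dK k V ((1 : A k V) ⊗ₜ[k] (o w ⊗ₜ[k] (1 : A k V))))) =
      ∑ j : Fin (z + 1), (-1 : k) ^ (j : ℕ) •
        (ψ (monomial u (Fin.cons (w j) (fun _ => v) : Fin (t + 1) → V) (j.removeNth w)) -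
        ract k V (SymmetricAlgebra.ι k V (w j))
          (ψ (monomial u (fun _ : Fin t => v) (j.removeNth w)))) := by
  rw [dK_o, tmulA_sum_right, map_sum]
  refine Finset.sum_congr rfl fun j _ => ?_
  have h : SymmetricAlgebra.ι k V (w j) ⊗ₜ[k] (o (j.removeNth w) ⊗ₜ[k] (1 : A k V)) =
      lact k V (SymmetricAlgebra.ι k V (w j)) (1 ⊗ₜ (o (j.removeNth w) ⊗ₜ 1)) := by simp
  rw [tmulA_smul_right, map_smul, tmulA_sub_right, map_sub, monomial_const,
    monomial_cons_const, ← hψ.2, h, ← tmulA_balanced, ract_tmul, ract_tmul, one_mul,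
    mul_comm (SymmetricAlgebra.ι k V v ^ t)]

lemma algebraMapInv_o {n : ℕ} (u : Fin (n + 1) → V) :
    ExteriorAlgebra.algebraMapInv (o u : ExteriorAlgebra k V) = 0 := by
  rw [← Fin.cons_self_tail u, o_cons, map_mul]
  simp [ExteriorAlgebra.algebraMapInv]

section Slices

variable {c : ℕ → ℕ → ℕ → ℕ → k} {ψ : KK k V →ₗ[k] K k V}
  {l₁ l₂ : A k V →ₗ[k] k} {f : Module.Dual k V} {v : V} {n : ℕ}

/-- On the term `v^r ⊗ ω ⊗ v^(t-1-r)` the differential becomes contraction with `l₁(x v^r)`, because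
`l₁` kills the powers of `v`. This form is `f` for `r = n` and `0` otherwise. -/
lemma slice_dK_monomial_left (hψ : HasCoeffs c ψ)
    (h₁' : ∀ a i, l₁ (SymmetricAlgebra.ι k V a * SymmetricAlgebra.ι k V v ^ i) =
      if i = n then f a else 0)
    (h₁ : ∀ i, l₁ (SymmetricAlgebra.ι k V v ^ i) = 0)
    (h₂ : ∀ i, l₂ (SymmetricAlgebra.ι k V v ^ i) = 1) {s z t : ℕ} (hn : n < t) (u : Fin s → V)
    (w : Fin z → V) :
    slice l₁ l₂ (dK k V (ψ (monomial u (fun _ : Fin t => v) w))) =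
      ((t.factorial : k) * c s t z (n + 1)) • contr f (o w * ExteriorAlgebra.ι k v * o u) := by
  rw [hψ.monomial_const, map_sum, map_sum, Finset.sum_eq_single ⟨n, hn⟩]
  · rw [map_smul, map_smul, slice_dK_tmul l₁ l₂ f]
    intro x
    simp [h₁', h₁, h₂]
  · intro r _ hr
    rw [map_smul, map_smul, slice_dK_tmul l₁ l₂ 0, contr_zero, smul_zero]
    intro x
    rw [h₁', h₁, if_neg fun h => hr (Fin.ext h)]
    simp
  · simp

/-- The minus sign is that of the right-hand term of `d_K`. The surviving term has `n` copies of `v`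
on the right, that is, zero-based `r = t - 1 - n`. -/
lemma slice_dK_monomial_right (hψ : HasCoeffs c ψ)
    (h₁ : ∀ i, l₁ (SymmetricAlgebra.ι k V v ^ i) = 1)
    (h₂' : ∀ a i, l₂ (SymmetricAlgebra.ι k V a * SymmetricAlgebra.ι k V v ^ i) =
      if i = n then f a else 0)
    (h₂ : ∀ i, l₂ (SymmetricAlgebra.ι k V v ^ i) = 0) {s z t : ℕ} (hn : n < t) (u : Fin s → V)
    (w : Fin z → V) :
    slice l₁ l₂ (dK k V (ψ (monomial u (fun _ : Fin t => v) w))) =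
      -((t.factorial : k) * c s t z (t - n)) • contr f (o w * ExteriorAlgebra.ι k v * o u) := by
  rw [hψ.monomial_const, map_sum, map_sum, Finset.sum_eq_single ⟨t - 1 - n, by omega⟩]
  · have e : t - 1 - n + 1 = t - n := by omega
    have e' : t - 1 - (t - 1 - n) = n := by omega
    rw [map_smul, map_smul, slice_dK_tmul l₁ l₂ (-f), contr_neg, e, smul_neg, neg_smul]
    intro x
    simp [h₁, h₂', h₂, e']
  · intro r _ hr
    rw [map_smul, map_smul, slice_dK_tmul l₁ l₂ 0, contr_zero, smul_zero]
    intro x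
    rw [h₂', h₂, if_neg fun h => hr (Fin.ext (by have := r.2; simp only; omega))]
    simp
  · simp

lemma slice_lact_monomial_left (hψ : HasCoeffs c ψ)
    (h₁ : ∀ a i, l₁ (SymmetricAlgebra.ι k V a * SymmetricAlgebra.ι k V v ^ i) =
      if i = n then f a else 0)
    (h₂ : ∀ i, l₂ (SymmetricAlgebra.ι k V v ^ i) = 1) {s z t : ℕ} (hn : n < t) (u : Fin s → V)
    (w : Fin z → V) (a : V) :
    slice l₁ l₂ (lact k V (SymmetricAlgebra.ι k V a) (ψ (monomial u (fun _ : Fin t => v) w))) =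
      ((t.factorial : k) * c s t z (n + 1) * f a) • (o w * ExteriorAlgebra.ι k v * o u) := by
  rw [hψ.monomial_const, map_sum, map_sum, Finset.sum_eq_single ⟨n, hn⟩]
  · simp [slice_tmul, h₁, h₂, smul_smul]
  · intro r _ hr
    rw [map_smul, map_smul, lact_tmul, slice_tmul, h₁, if_neg fun h => hr (Fin.ext h)]
    simp
  · simp

lemma slice_ract_monomial_right (hψ : HasCoeffs c ψ)
    (h₁ : ∀ i, l₁ (SymmetricAlgebra.ι k V v ^ i) = 1)
    (h₂ : ∀ a i, l₂ (SymmetricAlgebra.ι k V a * SymmetricAlgebra.ι k V v ^ i) =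
      if i = n then f a else 0) {s z t : ℕ} (hn : n < t) (u : Fin s → V)
    (w : Fin z → V) (a : V) :
    slice l₁ l₂ (ract k V (SymmetricAlgebra.ι k V a) (ψ (monomial u (fun _ : Fin t => v) w))) =
      ((t.factorial : k) * c s t z (t - n) * f a) • (o w * ExteriorAlgebra.ι k v * o u) := by
  rw [hψ.monomial_const, map_sum, map_sum, Finset.sum_eq_single ⟨t - 1 - n, by omega⟩]
  · have e : t - 1 - n + 1 = t - n := by omega
    have e' : t - 1 - (t - 1 - n) = n := by omega
    rw [map_smul, map_smul, ract_tmul, slice_tmul, h₁, mul_comm _ (SymmetricAlgebra.ι k V a), h₂, e,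
      e', if_pos rfl, one_mul, smul_smul]
  · intro r _ hr
    rw [map_smul, map_smul, ract_tmul, slice_tmul, mul_comm _ (SymmetricAlgebra.ι k V a), h₂,
      if_neg fun h => hr (Fin.ext (by have := r.2; simp only; omega))]
    simp
  · simp

lemma slice_lact_monomial_eq_zero (hψ : HasCoeffs c ψ)
    (h₂ : ∀ i, l₂ (SymmetricAlgebra.ι k V v ^ i) = 0) {s z t : ℕ} (u : Fin s → V)
    (w : Fin z → V) (a : A k V) :
    slice l₁ l₂ (lact k V a (ψ (monomial u (fun _ : Fin t => v) w))) = 0 := by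
  rw [hψ.monomial_const, map_sum, map_sum]
  exact Finset.sum_eq_zero fun r _ => by simp [slice_tmul, h₂]

lemma slice_ract_monomial_eq_zero (hψ : HasCoeffs c ψ)
    (h₁ : ∀ i, l₁ (SymmetricAlgebra.ι k V v ^ i) = 0) {s z t : ℕ} (u : Fin s → V)
    (w : Fin z → V) (a : A k V) :
    slice l₁ l₂ (ract k V a (ψ (monomial u (fun _ : Fin t => v) w))) = 0 := by
  rw [hψ.monomial_const, map_sum, map_sum]
  exact Finset.sum_eq_zero fun r _ => by simp [slice_tmul, h₁]

/-- The homotopy identity at a monomial `1 ⊗ o(u) ⊗ v ^ t ⊗ o(w) ⊗ 1`. -/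
lemma IsContractingHomotopy.monomial_const (hψ : IsContractingHomotopy ψ) {s z : ℕ} (t : ℕ)
    (u : Fin s → V) (v : V) (w : Fin z → V) :
    dK k V (ψ (monomial u (fun _ : Fin t => v) w)) +
      (ψ (tmulA (dK k V ((1 : A k V) ⊗ₜ[k] (o u ⊗ₜ[k] (SymmetricAlgebra.ι k V v ^ t))))
        ((1 : A k V) ⊗ₜ[k] (o w ⊗ₜ[k] (1 : A k V)))) +
      (-1 : k) ^ s • ψ (tmulA ((1 : A k V) ⊗ₜ[k] (o u ⊗ₜ[k] (SymmetricAlgebra.ι k V v ^ t)))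
        (dK k V ((1 : A k V) ⊗ₜ[k] (o w ⊗ₜ[k] (1 : A k V)))))) =
      ExteriorAlgebra.algebraMapInv (o u : ExteriorAlgebra k V) •
        ((SymmetricAlgebra.ι k V v ^ t) ⊗ₜ[k] (o w ⊗ₜ[k] (1 : A k V))) -
      ExteriorAlgebra.algebraMapInv (o w : ExteriorAlgebra k V) •
        ((1 : A k V) ⊗ₜ[k] (o u ⊗ₜ[k] (SymmetricAlgebra.ι k V v ^ t))) := by
  have h := LinearMap.congr_fun hψ (monomial u (fun _ : Fin t => v) w)
  rw [LinearMap.add_apply, LinearMap.comp_apply, LinearMap.comp_apply, KoszulSym.monomial_const,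
    dKK_tmulA, FK_tmulA, mu_tmul, mu_tmul, sgn_o, tmulA_smul_left, map_add, map_smul] at h
  rw [KoszulSym.monomial_const, h]
  simp

/-- The homotopy identity determines the coefficients for `s + 1` from those for `s`. -/
lemma IsContractingHomotopy.coeff_succ_left [CharZero k] [FiniteDimensional k V]
    (h : IsContractingHomotopy ψ) (hb : IsBilin ψ) (hc : HasCoeffs c ψ) {s z t : ℕ} (hn : n < t)
    (hd : z + 1 + s + 1 ≤ Module.finrank k V) :
    (-1) ^ z * c (s + 1) t z (n + 1) = c s t z (n + 1) - (n + 1) * c s (t + 1) z (n + 2) := by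
  obtain ⟨w, v, u, y, f, g, hy, hv, hw, hu, hg, hΩ⟩ := exists_family s z hd
  obtain ⟨l₁, h₁, h₁'⟩ := exists_form f g v n hv hg
  obtain ⟨l₂, h₂⟩ := exists_form_one g v hg
  have key := congrArg (slice l₁ l₂) (h.monomial_const t (Fin.cons y u : Fin (s + 1) → V) v w)
  -- `f` sees only `y`, so the contraction removes it; passing `w` and `v` costs the sign `-(-1)^z`.
  have e1 : contr f (o w * ExteriorAlgebra.ι k v * o (Fin.cons y u : Fin (s + 1) → V)) =
      -(-1 : k) ^ z • (o w * ExteriorAlgebra.ι k v * o u) := by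
    rw [mul_assoc, contr_o_mul f w hw, o_cons, contr_ι_mul, contr_ι_mul, contr_o f u hu, hv, hy]
    simp [mul_assoc]
  -- Only the term that extracts `y` survives, since `f` vanishes on the vectors of `u`. In `e3` no
  -- term survives, since `f` vanishes on `w`.
  have e2 : slice l₁ l₂ (ψ (tmulA (dK k V ((1 : A k V) ⊗ₜ[k]
        (o (Fin.cons y u : Fin (s + 1) → V) ⊗ₜ[k] (SymmetricAlgebra.ι k V v ^ t))))
        ((1 : A k V) ⊗ₜ[k] (o w ⊗ₜ[k] (1 : A k V))))) =
      ((t.factorial : k) * c s t z (n + 1) -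
        (t.factorial : k) * c s (t + 1) z (n + 2) * (n + 1)) •
        (o w * ExteriorAlgebra.ι k v * o u) := by
    rw [hb.apply_dK_tmulA, map_sum, Fin.sum_univ_succ, Finset.sum_eq_zero, add_zero]
    · rw [map_smul, map_sub, slice_lact_monomial_left hc h₁' h₂ hn,
        slice_monomial_cons_left hc h₁ h₁' h₂ hn]
      simp [hy, sub_smul]
    · intro j _
      rw [map_smul, map_sub, slice_lact_monomial_left hc h₁' h₂ hn,
        slice_monomial_cons_left hc h₁ h₁' h₂ hn]
      simp [hu]
  have e3 : slice l₁ l₂ (ψ (tmulA ((1 : A k V) ⊗ₜ[k]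
        (o (Fin.cons y u : Fin (s + 1) → V) ⊗ₜ[k] (SymmetricAlgebra.ι k V v ^ t)))
        (dK k V ((1 : A k V) ⊗ₜ[k] (o w ⊗ₜ[k] (1 : A k V)))))) = 0 := by
    cases z with
    | zero => simp [dK_zero, tmulA]
    | succ z =>
      rw [hb.apply_tmulA_dK, map_sum]
      refine Finset.sum_eq_zero fun j _ => ?_
      rw [map_smul, map_sub, slice_ract_monomial_eq_zero hc h₁,
        slice_monomial_cons_left hc h₁ h₁' h₂ hn, hw]
      simp
  -- With this `F_K` contributes nothing: its first term dies because `o(y, u)` has positive degree,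
  -- its second because `l₁ 1 = 0`.
  have e4 : l₁ 1 = 0 := by simpa using h₁ 0
  rw [map_add, map_add, map_smul, map_sub, map_smul, map_smul,
    slice_dK_monomial_left hc h₁' h₁ h₂ hn, e1, e2, e3, algebraMapInv_o, slice_tmul, slice_tmul, e4,
    smul_zero, add_zero, zero_smul, zero_mul, zero_smul, smul_zero, sub_zero, smul_smul,
    ← add_smul] at key
  have ht : (t.factorial : k) ≠ 0 := Nat.cast_ne_zero.2 t.factorial_ne_zero
  have := (smul_eq_zero.1 key).resolve_right hΩ
  apply mul_left_cancel₀ ht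
  linear_combination -this

/-- The homotopy identity determines the coefficients for `z + 1` from those for `z`. -/
lemma IsContractingHomotopy.coeff_succ_right [CharZero k] [FiniteDimensional k V]
    (h : IsContractingHomotopy ψ) (hb : IsBilin ψ) (hc : HasCoeffs c ψ) {s z t : ℕ} (hn : n < t)
    (hd : z + 1 + s + 1 ≤ Module.finrank k V) :
    (-1) ^ s * c s t (z + 1) (t - n) = (n + 1) * c s (t + 1) z (t - n) - c s t z (t - n) := by
  obtain ⟨w, v, u, y, f, g, hy, hv, hw, hu, hg, hΩ⟩ := exists_family s z hd
  obtain ⟨l₁, h₁⟩ := exists_form_one g v hg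
  obtain ⟨l₂, h₂, h₂'⟩ := exists_form f g v n hv hg
  have key := congrArg (slice l₁ l₂) (h.monomial_const t u v (Fin.cons y w : Fin (z + 1) → V))
  -- Here `y` comes first in the whole product, so no sign appears.
  have e1 : contr f (o (Fin.cons y w : Fin (z + 1) → V) * ExteriorAlgebra.ι k v * o u) =
      o w * ExteriorAlgebra.ι k v * o u := by
    rw [o_cons, mul_assoc, mul_assoc, contr_ι_mul, contr_o_mul f w hw, contr_ι_mul, contr_o f u hu,
      hv, hy]
    simp [mul_assoc]
  have e2 : slice l₁ l₂ (ψ (tmulA (dK k V ((1 : A k V) ⊗ₜ[k]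
        (o u ⊗ₜ[k] (SymmetricAlgebra.ι k V v ^ t))))
        ((1 : A k V) ⊗ₜ[k] (o (Fin.cons y w : Fin (z + 1) → V) ⊗ₜ[k] (1 : A k V))))) = 0 := by
    cases s with
    | zero => simp [dK_zero, tmulA]
    | succ s =>
      rw [hb.apply_dK_tmulA, map_sum]
      refine Finset.sum_eq_zero fun j _ => ?_
      rw [map_smul, map_sub, slice_lact_monomial_eq_zero hc h₂,
        slice_monomial_cons_right hc h₁ h₂ h₂' hn, hu]
      simp
  have e3 : slice l₁ l₂ (ψ (tmulA ((1 : A k V) ⊗ₜ[k]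
        (o u ⊗ₜ[k] (SymmetricAlgebra.ι k V v ^ t)))
        (dK k V ((1 : A k V) ⊗ₜ[k]
          (o (Fin.cons y w : Fin (z + 1) → V) ⊗ₜ[k] (1 : A k V)))))) =
      ((t.factorial : k) * c s (t + 1) z (t - n) * (n + 1) -
        (t.factorial : k) * c s t z (t - n)) •
        (o w * ExteriorAlgebra.ι k v * o u) := by
    rw [hb.apply_tmulA_dK, map_sum, Fin.sum_univ_succ, Finset.sum_eq_zero, add_zero]
    · rw [map_smul, map_sub, slice_ract_monomial_right hc h₁ h₂' hn,
        slice_monomial_cons_right hc h₁ h₂ h₂' hn]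
      simp [hy, sub_smul]
    · intro j _
      rw [map_smul, map_sub, slice_ract_monomial_right hc h₁ h₂' hn,
        slice_monomial_cons_right hc h₁ h₂ h₂' hn]
      simp [hw]
  have e4 : l₂ 1 = 0 := by simpa using h₂ 0
  rw [map_add, map_add, map_smul, map_sub, map_smul, map_smul,
    slice_dK_monomial_right hc h₁ h₂' h₂ hn, e1, e2, e3, algebraMapInv_o, slice_tmul, slice_tmul,
    e4, zero_add, zero_smul, mul_zero, zero_smul, smul_zero, sub_zero, smul_smul,
    ← add_smul] at key
  have ht : (t.factorial : k) ≠ 0 := Nat.cast_ne_zero.2 t.factorial_ne_zero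
  have := (smul_eq_zero.1 key).resolve_right hΩ
  have hs : ((-1 : k) ^ s) * (-1) ^ s = 1 := by rw [← mul_pow]; simp
  apply mul_left_cancel₀ ht
  linear_combination -(-1) ^ s * this + ((t.factorial : k) * c s (t + 1) z (t - n) * (n + 1) -
        (t.factorial : k) * c s t z (t - n)) * hs

end Slices

/-- Contracting homotopies of the given form agree in low degrees if they do for `s = z = 0`. -/
lemma IsContractingHomotopy.coeffs_unique [CharZero k] [FiniteDimensional k V]
    {η ξ : ℕ → ℕ → ℕ → ℕ → k} {ψ φ : KK k V →ₗ[k] K k V}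
    (h : IsContractingHomotopy ψ) (hb : IsBilin ψ)
    (hc : HasCoeffs (fun s t z r => (-1) ^ (s * z + z) * η s t z r) ψ)
    (h' : IsContractingHomotopy φ) (hb' : IsBilin φ)
    (hc' : HasCoeffs (fun s t z r => (-1) ^ (s * z + z) * ξ s t z r) φ)
    (h0 : ∀ t r : ℕ, 1 ≤ r → r ≤ t → η 0 t 0 r = ξ 0 t 0 r) (s t z r : ℕ) (hr : 1 ≤ r)
    (hrt : r ≤ t) (hd : s + t + z ≤ Module.finrank k V) : η s t z r = ξ s t z r := by
  -- Each recursion trades one vector of `u` or `w` for at most one more factor `v`. Thus `s + t +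
  -- z` never grows and the dimension bound persists. As `t ≥ 1`, the bound leaves room for `w`,
  -- `v`, `u` and `y`.
  induction z generalizing t r with
  | zero =>
    induction s generalizing t r with
    | zero => exact h0 t r hr hrt
    | succ s ih =>
      obtain ⟨n, rfl⟩ := Nat.exists_eq_add_of_le' hr
      have e := h.coeff_succ_left hb hc (s := s) (z := 0) (n := n) hrt (by omega)
      have e' := h'.coeff_succ_left hb' hc' (s := s) (z := 0) (n := n) hrt (by omega)
      simp only [mul_zero, add_zero, pow_zero, one_mul] at e e'
      rw [e, e', ih t (n + 1) (by omega) hrt (by omega), ih (t + 1) (n + 2) (by omega) (by omega)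
        (by omega)]
  | succ z ih =>
    obtain ⟨n, hn, rfl⟩ : ∃ n, n < t ∧ r = t - n := ⟨t - r, by omega, by omega⟩
    have e := h.coeff_succ_right hb hc (s := s) (z := z) hn (by omega)
    have e' := h'.coeff_succ_right hb' hc' (s := s) (z := z) hn (by omega)
    rw [ih t (t - n) hr hrt (by omega), ih (t + 1) (t - n) hr (by omega) (by omega), ← e'] at e
    -- Both families carry the same sign, so it can be cancelled.
    have h1 : (-1 : k) ^ s * (-1) ^ (s * (z + 1) + (z + 1)) ≠ 0 := by simp
    rw [← mul_assoc, ← mul_assoc] at e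
    exact mul_left_cancel₀ h1 e

lemma HasCoeffs.congr {c c' : ℕ → ℕ → ℕ → ℕ → k} {φ : KK k V →ₗ[k] K k V} (h : HasCoeffs c φ)
    (hc : ∀ s t z r, 1 ≤ r → r ≤ t → c s t z r = c' s t z r) : HasCoeffs c' φ := by
  intro s t z u v w
  rw [h]
  refine Finset.sum_congr rfl fun r _ => Finset.sum_congr rfl fun σ _ => ?_
  rw [hc s t z (r + 1) (by omega) r.2]

end KoszulSym
end

theorem lemma3p2 {k V : Type*} [Field k] [CharZero k] [AddCommGroup V] [Module k V]
    [FiniteDimensional k V] :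
    -- the map `φ` is well defined, is `GL(V)`-invariant, and is a contracting homotopy
    (∃ φ : KoszulSym.KK k V →ₗ[k] KoszulSym.K k V,
      (KoszulSym.IsBilin φ ∧
        KoszulSym.HasCoeffs (fun s t z r => (KoszulSym.coeff s t z r : k)) φ) ∧
      (∀ ψ : KoszulSym.KK k V →ₗ[k] KoszulSym.K k V, KoszulSym.IsBilin ψ →
        KoszulSym.HasCoeffs (fun s t z r => (KoszulSym.coeff s t z r : k)) ψ → ψ = φ) ∧
      KoszulSym.IsGLInvariant φ ∧
      KoszulSym.IsContractingHomotopy φ) ∧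
    -- its coefficients are the `(-1)^(sz+z) ξ_r^{s,t,z}`
    (∀ s t z r : ℕ, 1 ≤ r → r ≤ t →
      KoszulSym.coeff s t z r = (-1) ^ (s * z + z) * KoszulSym.xi s t z r) ∧
    -- the coefficients are unique as soon as `dim V` is large enough
    (∀ (η : ℕ → ℕ → ℕ → ℕ → k) (ψ : KoszulSym.KK k V →ₗ[k] KoszulSym.K k V),
      (∀ t r : ℕ, 1 ≤ r → r ≤ t → η 0 t 0 r = 1 / (t.factorial : k)) →
      KoszulSym.IsBilin ψ →
      KoszulSym.HasCoeffs (fun s t z r => (-1) ^ (s * z + z) * η s t z r) ψ →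
      KoszulSym.IsContractingHomotopy ψ →
      ∀ s t z r : ℕ, 1 ≤ r → r ≤ t → s + t + z ≤ Module.finrank k V →
        η s t z r = (KoszulSym.xi s t z r : k)) := by
  have hb : KoszulSym.IsBilin (KoszulSym.homotopy k V) := KoszulSym.homotopy_isBilin
  have hc : KoszulSym.HasCoeffs (fun s t z r => (KoszulSym.coeff s t z r : k))
    (KoszulSym.homotopy k V) := KoszulSym.homotopy_hasCoeffs
  have hh : KoszulSym.IsContractingHomotopy (KoszulSym.homotopy k V) :=
    KoszulSym.homotopy_isContractingHomotopy
  refine ⟨⟨KoszulSym.homotopy k V, ⟨hb, hc⟩, fun ψ h h' => KoszulSym.HasCoeffs.unique h hb h' hc,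
    KoszulSym.HasCoeffs.isGLInvariant hb hc, hh⟩, fun s t z r => KoszulSym.coeff_eq_xi s t z r, ?_⟩
  intro η ψ h0 hψ hη h
  -- The constructed homotopy, with its coefficients rewritten through `ξ`, is the solution that `ψ`
  -- is compared with. What remains is that its coefficients for `s = z = 0` are also `1 / t!`.
  refine h.coeffs_unique hψ hη hh hb (hc.congr fun s t z r hr hrt => ?_) fun t r hr hrt => ?_
  · simp [KoszulSym.coeff_eq_xi s t z r hr hrt]
  · rw [h0 t r hr hrt]
    have h1 : ((r - 1).factorial : k) ≠ 0 := Nat.cast_ne_zero.2 (Nat.factorial_ne_zero _)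
    have h2 : ((t - r).factorial : k) ≠ 0 := Nat.cast_ne_zero.2 (Nat.factorial_ne_zero _)
    have h3 : (t.factorial : k) ≠ 0 := Nat.cast_ne_zero.2 (Nat.factorial_ne_zero _)
    simp only [KoszulSym.xi]
    push_cast
    simp only [add_zero, zero_add]
    field_simp
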